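/- Let $\underline G=(G\rightrightarrows M)$ be a Lie groupoid ($G$, $M$ finite-dimensional smooth manifolds without boundary). A *VB-groupoid* $\underline\Gamma=(\Gamma\rightrightarrows E)$ over $\underline G$ consists of smooth real vector bundles of finite rank $\Gamma\to G$ and $E\to M$ and a Lie groupoid structure $\Gamma\rightrightarrows E$ whose structure maps are linear and for which the two bundle projections form a Lie groupoid morphism $\underline\Gamma\to\underline G$. A *VB-map over $\underline G$* is a Lie groupoid morphism $\underline\Gamma'\to\underline\Gamma$ that covers the identity of $\underline G$ and is fiberwise linear. An *isomorphism* $\alpha:\phi\cong\psi$ between VB-maps $\phi,\psi:\underline\Gamma'\to\underline\Gamma$ over $\underline G$ is a smooth vector bundle map $\alpha:E'\to\Gamma|_M$ over $\mathrm{id}_M$ such that $s\,\alpha(e)=\phi(e)$, $t\,\alpha(e)=\psi(e)$ for all $e\in E'$, and $\psi(v)\,\alpha(e)=\alpha(e')\,\phi(v)$ for every arrow $v:e\to e'$ of $\underline\Gamma'$. Two VB-groupoids over $\underline G$ are *equivalent* if there is a VB-map over $\underline G$ between them that has a quasi-inverse, that is, an inverse up to isomorphisms of VB-maps over $\underline G$;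 they are *isomorphic* if there are mutually inverse VB-maps over $\underline G$ between them. A VB-groupoid $\underline\Gamma$ over $\underline G$ is *acyclic* if its anchor $\partial=t|_C:C\to E$, where $C=\ker(s:\Gamma\to E)|_M$ is the core, is an isomorphism on each fiber. The direct sum $\underline\Gamma\oplus\underline\Omega$ of VB-groupoids over $\underline G$ is the direct sum of the vector bundles with the componentwise structure maps. Then two VB-groupoids $\underline\Gamma,\underline\Gamma'$ over $\underline G$ are equivalent if and only if there are acyclic VB-groupoids $\underline\Omega,\underline\Omega'$ over $\underline G$ such that $\underline\Gamma\oplus\underline\Omega$ and $\underline\Gamma'\oplus\underline\Omega'$ are isomorphic as VB-groupoids over $\underline G$. -/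

import Mathlib

open Bundle
open scoped Manifold ContDiff Bundle Topology

universe v

/-! ### Fiberwise linear maps and submersions

Auxiliary facts: a smooth fiberwise linear map of vector bundles over a submersion is a submersion
if and only if it is fiberwise surjective. They are needed to see that the direct sum of two
VB-groupoids is a Lie groupoid. -/

namespace VBAux

section
variable {EB HB B EM HM M F F' : Type*}
  [NormedAddCommGroup EB] [NormedSpace ℝ EB] [TopologicalSpace HB]
  [TopologicalSpace B] [ChartedSpace HB B] {I : ModelWithCorners ℝ EB HB}
  [NormedAddCommGroup EM] [NormedSpace ℝ EM] [TopologicalSpace HM]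
  [TopologicalSpace M] [ChartedSpace HM M] {J : ModelWithCorners ℝ EM HM}
  [NormedAddCommGroup F] [NormedSpace ℝ F]
  [NormedAddCommGroup F'] [NormedSpace ℝ F']
  {E : B → Type*} [TopologicalSpace (TotalSpace F E)] [∀ x, TopologicalSpace (E x)] [FiberBundle F E]
  [∀ x, AddCommGroup (E x)] [∀ x, Module ℝ (E x)] [VectorBundle ℝ F E] [ContMDiffVectorBundle ∞ F E I]
  {E' : M → Type*} [TopologicalSpace (TotalSpace F' E')] [∀ x, TopologicalSpace (E' x)] [FiberBundle F' E']
  [∀ x, AddCommGroup (E' x)] [∀ x, Module ℝ (E' x)] [VectorBundle ℝ F' E'] [ContMDiffVectorBundle ∞ F' E' J]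


theorem triv_mdifferentiable (e : Trivialization F (π F E)) [MemTrivializationAtlas e] :
    e.toOpenPartialHomeomorph.MDifferentiable (I.prod 𝓘(ℝ, F)) (I.prod 𝓘(ℝ, F)) :=
  ⟨(e.contMDiffOn (IB := I) (n := ∞)).mdifferentiableOn (by simp),
    (e.contMDiffOn_symm (IB := I) (n := ∞)).mdifferentiableOn (by simp)⟩

theorem surj_iff {α β γ δ : Type*} {i : α → β} {k : β → γ} {j : γ → δ}
    (hi : Function.Bijective i) (hj : Function.Bijective j) :
    Function.Surjective (j ∘ (k ∘ i)) ↔ Function.Surjective k := by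
  constructor
  · intro h c
    obtain ⟨a, ha⟩ := h (j c)
    exact ⟨i a, hj.1 ha⟩
  · intro h
    exact hj.2.comp (h.comp hi.2)

theorem bundleMap_local [FiniteDimensional ℝ F] {f : B → M} (hf : ContMDiff I J ∞ f)
    {Φ : TotalSpace F E → TotalSpace F' E'}
    (hΦ : ContMDiff (I.prod 𝓘(ℝ, F)) (J.prod 𝓘(ℝ, F')) ∞ Φ)
    (L : ∀ b, E b →ₗ[ℝ] E' (f b)) (hL : ∀ b v, Φ ⟨b, v⟩ = ⟨f b, L b v⟩) (g : B) (v : E g) :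
    ∃ (T : F →ₗ[ℝ] F') (D : EB →L[ℝ] F'),
      (v = 0 → D = 0) ∧
      (Function.Surjective T ↔ Function.Surjective (L g)) ∧
      (Function.Surjective (mfderiv (I.prod 𝓘(ℝ, F)) (J.prod 𝓘(ℝ, F')) Φ ⟨g, v⟩) ↔
        Function.Surjective (fun p : EB × F =>
          (((mfderiv I J f g : EB →L[ℝ] EM) p.1, D p.1 + T p.2) : EM × F'))) := by
  set e := trivializationAt F E g with he
  set φ := trivializationAt F' E' (f g) with hφ
  have hge : g ∈ e.baseSet := mem_baseSet_trivializationAt F E g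
  have hgφ : f g ∈ φ.baseSet := mem_baseSet_trivializationAt F' E' (f g)
  let T : F →ₗ[ℝ] F' := (φ.linearMapAt ℝ (f g)) ∘ₗ L g ∘ₗ e.symmₗ ℝ g
  set w : F := (e ⟨g, v⟩).2 with hw
  have hw' : e ⟨g, v⟩ = (g, w) := by
    apply Prod.ext
    · exact e.coe_fst' hge
    · rfl
  let A : B × F → F' := fun q => (φ (Φ (e.toOpenPartialHomeomorph.symm q))).2
  let h : B × F → M × F' := fun q => φ (Φ (e.toOpenPartialHomeomorph.symm q))
  have hsymm : ∀ b ∈ e.baseSet, ∀ c, e.toOpenPartialHomeomorph.symm (b, c) = ⟨b, e.symm b c⟩ :=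
    fun b hb c => (e.mk_symm hb c).symm
  have hA : ∀ b ∈ e.baseSet, f b ∈ φ.baseSet → ∀ c, A (b, c) = φ.linearMapAt ℝ (f b) (L b (e.symmₗ ℝ b c)) := by
    intro b hb hfb c
    simp only [A]
    rw [hsymm b hb, hL, φ.coe_linearMapAt_of_mem hfb, e.symmₗ_apply hb]
  have hh : ∀ b ∈ e.baseSet, f b ∈ φ.baseSet → ∀ c, h (b, c) = (f b, A (b, c)) := by
    intro b hb hfb c
    apply Prod.ext
    · simp only [h]
      rw [hsymm b hb, hL]
      exact φ.coe_fst' hfb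
    · rfl
  have hev : ∀ᶠ b in 𝓝 g, b ∈ e.baseSet ∧ f b ∈ φ.baseSet :=
    Filter.Eventually.and (e.open_baseSet.mem_nhds hge)
      (hf.continuous.continuousAt.preimage_mem_nhds (φ.open_baseSet.mem_nhds hgφ))
  have hT : ∀ c, A (g, c) = T c := fun c => hA g hge hgφ c
  have hmemφ : Φ ⟨g, v⟩ ∈ φ.source := by rw [hL, φ.mem_source]; exact hgφ
  have hmeme : (⟨g, v⟩ : TotalSpace F E) ∈ e.source := by rw [e.mem_source]; exact hge
  have hsymmw : e.toOpenPartialHomeomorph.symm (g, w) = ⟨g, v⟩ := by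
    rw [← hw']
    exact e.toOpenPartialHomeomorph.left_inv hmeme
  have hgw : (g, w) ∈ e.target := by rw [← hw']; exact e.toOpenPartialHomeomorph.map_source hmeme
  have d1 : MDifferentiableAt (I.prod 𝓘(ℝ, F)) (I.prod 𝓘(ℝ, F)) e.toOpenPartialHomeomorph.symm (g, w) :=
    (triv_mdifferentiable (I := I) e).mdifferentiableAt_symm hgw
  have d2 : MDifferentiableAt (I.prod 𝓘(ℝ, F)) (J.prod 𝓘(ℝ, F')) Φ (e.toOpenPartialHomeomorph.symm (g, w)) :=
    (hΦ _).mdifferentiableAt (by simp)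
  have d3 : MDifferentiableAt (J.prod 𝓘(ℝ, F')) (J.prod 𝓘(ℝ, F')) φ (Φ (e.toOpenPartialHomeomorph.symm (g, w))) := by
    rw [hsymmw]
    exact (triv_mdifferentiable (I := J) φ).mdifferentiableAt hmemφ
  have d4 := d2.comp (g, w) d1
  have dh : MDifferentiableAt (I.prod 𝓘(ℝ, F)) (J.prod 𝓘(ℝ, F')) h (g, w) := d3.comp (g, w) d4
  have dA : MDifferentiableAt (I.prod 𝓘(ℝ, F)) 𝓘(ℝ, F') A (g, w) := dh.snd
  have key1 : mfderiv (I.prod 𝓘(ℝ, F)) (J.prod 𝓘(ℝ, F')) h (g, w) =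
      (mfderiv (J.prod 𝓘(ℝ, F')) (J.prod 𝓘(ℝ, F')) φ (Φ (e.toOpenPartialHomeomorph.symm (g, w)))).comp
        ((mfderiv (I.prod 𝓘(ℝ, F)) (J.prod 𝓘(ℝ, F')) Φ (e.toOpenPartialHomeomorph.symm (g, w))).comp
          (mfderiv (I.prod 𝓘(ℝ, F)) (I.prod 𝓘(ℝ, F)) e.toOpenPartialHomeomorph.symm (g, w))) := by
    rw [← mfderiv_comp (g, w) d2 d1]
    exact mfderiv_comp (g, w) d3 d4
  have b1 : Function.Bijective (mfderiv (I.prod 𝓘(ℝ, F)) (I.prod 𝓘(ℝ, F)) e.toOpenPartialHomeomorph.symm (g, w)) :=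
    (triv_mdifferentiable (I := I) e).symm.mfderiv_bijective hgw
  have b3 : Function.Bijective (mfderiv (J.prod 𝓘(ℝ, F')) (J.prod 𝓘(ℝ, F')) φ (Φ ⟨g, v⟩)) :=
    (triv_mdifferentiable (I := J) φ).mfderiv_bijective hmemφ
  have hev2 : h =ᶠ[𝓝 (g, w)] fun q => (f q.1, A q) := by
    have : ∀ᶠ q : B × F in 𝓝 (g, w), q.1 ∈ e.baseSet ∧ f q.1 ∈ φ.baseSet :=
      (continuous_fst.tendsto (g, w)).eventually hev
    filter_upwards [this] with q hq
    exact hh q.1 hq.1 hq.2 q.2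
  have df : MDifferentiableAt I J f g := (hf g).mdifferentiableAt (by simp)
  let DA : EB →L[ℝ] F' := mfderiv I 𝓘(ℝ, F') (fun b => A (b, w)) g
  have key2 : ∀ p : EB × F, mfderiv (I.prod 𝓘(ℝ, F)) (J.prod 𝓘(ℝ, F')) h (g, w) p =
      (((mfderiv I J f g : EB →L[ℝ] EM) p.1,
        DA p.1 + T p.2) : EM × F') := by
    intro p
    have dfst : MDifferentiableAt (I.prod 𝓘(ℝ, F)) J (fun q : B × F => f q.1) (g, w) :=
      MDifferentiableAt.comp (g, w) (g := f) (f := Prod.fst) df mdifferentiableAt_fst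
    rw [hev2.mfderiv_eq, mfderiv_prodMk dfst dA]
    refine Prod.ext ?_ ?_
    · change mfderiv (I.prod 𝓘(ℝ, F)) J (f ∘ Prod.fst) (g, w) p = _
      rw [mfderiv_comp (I' := I) (g, w) df mdifferentiableAt_fst, mfderiv_fst]
      rfl
    · change mfderiv (I.prod 𝓘(ℝ, F)) 𝓘(ℝ, F') A (g, w) p = _
      refine (mfderiv_prod_eq_add_apply dA).trans ?_
      refine congrArg (fun z : F' => (DA p.1 + z : F')) ?_
      have : (fun z => A (g, z)) = T.toContinuousLinearMap := by
        funext z; exact hT z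
      change mfderiv 𝓘(ℝ, F) 𝓘(ℝ, F') (fun z => A (g, z)) w p.2 = T p.2
      rw [this, ContinuousLinearMap.mfderiv_eq]
      rfl
  refine ⟨T, DA, ?_, ?_, ?_⟩
  · intro hv
    have hw0 : w = 0 := by
      rw [hw, hv]
      exact (e.linear ℝ hge).map_zero
    have : (fun b => A (b, w)) =ᶠ[𝓝 g] fun _ => 0 := by
      filter_upwards [hev] with b hb
      rw [hA b hb.1 hb.2, hw0]
      simp
    exact this.mfderiv_eq.trans (mfderiv_const ..)
  · have b1 : Function.Bijective (φ.linearMapAt ℝ (f g)) := by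
      rw [φ.linearMapAt_def_of_mem hgφ]
      exact (φ.linearEquivAt ℝ (f g) hgφ).bijective
    have b2 : Function.Bijective (e.symmₗ ℝ g) := by
      have : ⇑(e.symmₗ ℝ g) = (e.linearEquivAt ℝ g hge).symm := by
        funext y; exact e.symmₗ_apply hge y
      rw [this]
      exact (e.linearEquivAt ℝ g hge).symm.bijective
    change Function.Surjective (⇑(φ.linearMapAt ℝ (f g)) ∘ (L g ∘ e.symmₗ ℝ g)) ↔ _
    exact surj_iff b2 b1
  · have : Function.Surjective (mfderiv (I.prod 𝓘(ℝ, F)) (J.prod 𝓘(ℝ, F')) h (g, w)) ↔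
      Function.Surjective (mfderiv (I.prod 𝓘(ℝ, F)) (J.prod 𝓘(ℝ, F')) Φ ⟨g, v⟩) := by
      rw [key1, ← hsymmw]
      rw [← hsymmw] at b3
      exact surj_iff b1 b3
    rw [← this]
    exact iff_of_eq (congrArg Function.Surjective (funext key2))


theorem bundleMap_fiber_surjective [FiniteDimensional ℝ F] {f : B → M} (hf : ContMDiff I J ∞ f)
    {Φ : TotalSpace F E → TotalSpace F' E'}
    (hΦ : ContMDiff (I.prod 𝓘(ℝ, F)) (J.prod 𝓘(ℝ, F')) ∞ Φ)
    (L : ∀ b, E b →ₗ[ℝ] E' (f b)) (hL : ∀ b v, Φ ⟨b, v⟩ = ⟨f b, L b v⟩)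
    (hs : ∀ p, Function.Surjective (mfderiv (I.prod 𝓘(ℝ, F)) (J.prod 𝓘(ℝ, F')) Φ p)) (g : B) :
    Function.Surjective (L g) := by
  obtain ⟨T, D, hD, hT, hS⟩ := bundleMap_local hf hΦ L hL g 0
  rw [← hT]
  intro c
  obtain ⟨p, hp⟩ := hS.1 (hs _) (0, c)
  refine ⟨p.2, ?_⟩
  have := congrArg Prod.snd hp
  simpa [hD rfl] using this

theorem bundleMap_mfderiv_surjective [FiniteDimensional ℝ F] {f : B → M} (hf : ContMDiff I J ∞ f)
    (hfs : ∀ b, Function.Surjective (mfderiv I J f b))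
    {Φ : TotalSpace F E → TotalSpace F' E'}
    (hΦ : ContMDiff (I.prod 𝓘(ℝ, F)) (J.prod 𝓘(ℝ, F')) ∞ Φ)
    (L : ∀ b, E b →ₗ[ℝ] E' (f b)) (hL : ∀ b v, Φ ⟨b, v⟩ = ⟨f b, L b v⟩)
    (hs : ∀ b, Function.Surjective (L b)) (p : TotalSpace F E) :
    Function.Surjective (mfderiv (I.prod 𝓘(ℝ, F)) (J.prod 𝓘(ℝ, F')) Φ p) := by
  obtain ⟨T, D, -, hT, hS⟩ := bundleMap_local hf hΦ L hL p.1 p.2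
  refine hS.2 ?_
  rintro ⟨m, c⟩
  obtain ⟨a, ha⟩ := hfs p.1 m
  obtain ⟨b, hb⟩ := hT.2 (hs p.1) (c - D a)
  exact ⟨(a, b), Prod.ext ha (by simp [hb])⟩

end

end VBAux

/-! ### Lie groupoids -/

section Groupoid

variable {EG HG G EM HM M EG' HG' G' EM' HM' M' EG'' HG'' G'' EM'' HM'' M'' : Type*}
  [NormedAddCommGroup EG] [NormedSpace ℝ EG] [TopologicalSpace HG]
  [TopologicalSpace G] [ChartedSpace HG G]
  [NormedAddCommGroup EM] [NormedSpace ℝ EM] [TopologicalSpace HM]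
  [TopologicalSpace M] [ChartedSpace HM M]
  [NormedAddCommGroup EG'] [NormedSpace ℝ EG'] [TopologicalSpace HG']
  [TopologicalSpace G'] [ChartedSpace HG' G']
  [NormedAddCommGroup EM'] [NormedSpace ℝ EM'] [TopologicalSpace HM']
  [TopologicalSpace M'] [ChartedSpace HM' M']
  [NormedAddCommGroup EG''] [NormedSpace ℝ EG''] [TopologicalSpace HG'']
  [TopologicalSpace G''] [ChartedSpace HG'' G'']
  [NormedAddCommGroup EM''] [NormedSpace ℝ EM''] [TopologicalSpace HM'']
  [TopologicalSpace M''] [ChartedSpace HM'' M'']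

/-- A smooth submersion (between finite-dimensional manifolds without boundary): a smooth map all
of whose differentials are surjective. -/
structure IsSmoothSubmersion (I : ModelWithCorners ℝ EG HG) (J : ModelWithCorners ℝ EM HM)
    (f : G → M) : Prop where
  contMDiff : ContMDiff I J ∞ f
  mfderiv_surjective : ∀ x, Function.Surjective (mfderiv I J f x)

/-- A Lie groupoid `G ⇉ M` on the manifolds `G` (arrows) and `M` (objects). An arrow `g` goes from
`src g` to `tgt g`, and `mul g h` is the composite `g ∘ h`. The product `mul` is only meaningful on
the fibered product `{(g, h) | src g = tgt h}`, an embedded submanifold of `G × G`; its values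
elsewhere are irrelevant, and smoothness is required on that submanifold. -/
structure LieGroupoid (IG : ModelWithCorners ℝ EG HG) (G : Type*) [TopologicalSpace G]
    [ChartedSpace HG G] (IM : ModelWithCorners ℝ EM HM) (M : Type*) [TopologicalSpace M]
    [ChartedSpace HM M] where
  src : G → M
  tgt : G → M
  unit : M → G
  inv : G → G
  mul : G → G → G
  src_surjective : Function.Surjective src
  tgt_surjective : Function.Surjective tgt
  src_submersion : IsSmoothSubmersion IG IM src
  tgt_submersion : IsSmoothSubmersion IG IM tgt
  unit_smooth : ContMDiff IM IG ∞ unit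
  inv_smooth : ContMDiff IG IG ∞ inv
  mul_smooth : ContMDiffOn (IG.prod IG) IG ∞ (fun p : G × G => mul p.1 p.2)
    {p | src p.1 = tgt p.2}
  src_unit : ∀ x, src (unit x) = x
  tgt_unit : ∀ x, tgt (unit x) = x
  src_inv : ∀ g, src (inv g) = tgt g
  tgt_inv : ∀ g, tgt (inv g) = src g
  src_mul : ∀ g h, src g = tgt h → src (mul g h) = src h
  tgt_mul : ∀ g h, src g = tgt h → tgt (mul g h) = tgt g
  mul_assoc : ∀ g h k, src g = tgt h → src h = tgt k → mul (mul g h) k = mul g (mul h k)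
  unit_mul : ∀ g, mul (unit (tgt g)) g = g
  mul_unit : ∀ g, mul g (unit (src g)) = g
  inv_mul : ∀ g, mul (inv g) g = unit (src g)
  mul_inv : ∀ g, mul g (inv g) = unit (tgt g)

namespace LieGroupoid

variable {IG : ModelWithCorners ℝ EG HG} {IM : ModelWithCorners ℝ EM HM}
  {IG' : ModelWithCorners ℝ EG' HG'} {IM' : ModelWithCorners ℝ EM' HM'}
  {IG'' : ModelWithCorners ℝ EG'' HG''} {IM'' : ModelWithCorners ℝ EM'' HM''}

/-- The pair `(φ₁, φ₀)` of maps on arrows and objects is a morphism of Lie groupoids. -/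
structure IsHom (A : LieGroupoid IG G IM M) (A' : LieGroupoid IG' G' IM' M')
    (φ₁ : G → G') (φ₀ : M → M') : Prop where
  smooth_arr : ContMDiff IG IG' ∞ φ₁
  smooth_obj : ContMDiff IM IM' ∞ φ₀
  map_src : ∀ g, φ₀ (A.src g) = A'.src (φ₁ g)
  map_tgt : ∀ g, φ₀ (A.tgt g) = A'.tgt (φ₁ g)
  map_unit : ∀ x, φ₁ (A.unit x) = A'.unit (φ₀ x)
  map_inv : ∀ g, φ₁ (A.inv g) = A'.inv (φ₁ g)
  map_mul : ∀ g h, A.src g = A.tgt h → φ₁ (A.mul g h) = A'.mul (φ₁ g) (φ₁ h)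

theorem IsHom.id (A : LieGroupoid IG G IM M) : IsHom A A (fun g => g) (fun x => x) where
  smooth_arr := contMDiff_id
  smooth_obj := contMDiff_id
  map_src _ := rfl
  map_tgt _ := rfl
  map_unit _ := rfl
  map_inv _ := rfl
  map_mul _ _ _ := rfl

theorem IsHom.comp {A : LieGroupoid IG G IM M} {A' : LieGroupoid IG' G' IM' M'}
    {A'' : LieGroupoid IG'' G'' IM'' M''} {ψ₁ : G' → G''} {ψ₀ : M' → M''} {φ₁ : G → G'}
    {φ₀ : M → M'} (hψ : IsHom A' A'' ψ₁ ψ₀) (hφ : IsHom A A' φ₁ φ₀) :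
    IsHom A A'' (fun g => ψ₁ (φ₁ g)) (fun x => ψ₀ (φ₀ x)) where
  smooth_arr := hψ.smooth_arr.comp hφ.smooth_arr
  smooth_obj := hψ.smooth_obj.comp hφ.smooth_obj
  map_src g := by rw [hφ.map_src, hψ.map_src]
  map_tgt g := by rw [hφ.map_tgt, hψ.map_tgt]
  map_unit x := by rw [hφ.map_unit, hψ.map_unit]
  map_inv g := by rw [hφ.map_inv, hψ.map_inv]
  map_mul g h H := by
    rw [hφ.map_mul g h H, hψ.map_mul]
    rw [← hφ.map_src, ← hφ.map_tgt, H]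

end LieGroupoid

end Groupoid

/-! ### Smooth vector bundles -/

/-- A smooth real vector bundle of finite rank over a manifold `B`, bundled: `Model` is the typical
fiber and `Fiber b` is the fiber over `b`. -/
structure SmoothVectorBundle {EB HB : Type*}
    [NormedAddCommGroup EB] [NormedSpace ℝ EB] [TopologicalSpace HB]
    (I : ModelWithCorners ℝ EB HB) (B : Type*) [TopologicalSpace B] [ChartedSpace HB B] where
  Model : Type v
  Fiber : B → Type v
  [normedAddCommGroup : NormedAddCommGroup Model]
  [normedSpace : NormedSpace ℝ Model]
  [finiteDimensional : FiniteDimensional ℝ Model]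
  [addCommGroup : ∀ b, AddCommGroup (Fiber b)]
  [module : ∀ b, Module ℝ (Fiber b)]
  [fiberTopology : ∀ b, TopologicalSpace (Fiber b)]
  [totalTopology : TopologicalSpace (TotalSpace Model Fiber)]
  [fiberBundle : FiberBundle Model Fiber]
  [vectorBundle : VectorBundle ℝ Model Fiber]
  [contMDiffVectorBundle : ContMDiffVectorBundle ∞ Model Fiber I]

namespace SmoothVectorBundle

attribute [instance] normedAddCommGroup normedSpace finiteDimensional addCommGroup module
  fiberTopology totalTopology fiberBundle vectorBundle contMDiffVectorBundle

variable {EB HB B EB' HB' B' : Type*}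
  [NormedAddCommGroup EB] [NormedSpace ℝ EB] [TopologicalSpace HB]
  [TopologicalSpace B] [ChartedSpace HB B]
  [NormedAddCommGroup EB'] [NormedSpace ℝ EB'] [TopologicalSpace HB']
  [TopologicalSpace B'] [ChartedSpace HB' B']
  {I : ModelWithCorners ℝ EB HB} {I' : ModelWithCorners ℝ EB' HB'}

/-- The total space. It is a manifold through Mathlib's charted space structure. -/
abbrev Total (E : SmoothVectorBundle I B) : Type _ := TotalSpace E.Model E.Fiber

/-- The model with corners of the total space. -/
noncomputable abbrev totalModel (E : SmoothVectorBundle I B) : ModelWithCorners ℝ (EB × E.Model)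
    (ModelProd HB E.Model) := I.prod 𝓘(ℝ, E.Model)

/-- The map `Φ` of total spaces covers `f` and is linear on each fiber. -/
def IsLinearOver (E : SmoothVectorBundle I B) (E' : SmoothVectorBundle I' B') (f : B → B')
    (Φ : E.Total → E'.Total) : Prop :=
  ∃ L : ∀ b, E.Fiber b →ₗ[ℝ] E'.Fiber (f b), ∀ b v, Φ ⟨b, v⟩ = ⟨f b, L b v⟩

/-- The direct (Whitney) sum of two vector bundles over the same base. -/
@[simps Model Fiber]
noncomputable def sum (E E' : SmoothVectorBundle I B) : SmoothVectorBundle I B where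
  Model := E.Model × E'.Model
  Fiber := E.Fiber ×ᵇ E'.Fiber

section Sum

variable {E E' : SmoothVectorBundle I B}

/-- The projection of a direct sum onto the first summand. -/
def sumFst (p : (E.sum E').Total) : E.Total := ⟨p.1, p.2.1⟩

/-- The projection of a direct sum onto the second summand. -/
def sumSnd (p : (E.sum E').Total) : E'.Total := ⟨p.1, p.2.2⟩

open Classical in
/-- The vector `(a, b)` of the direct sum, for `a` and `b` in fibers over the same point (the
second component is `0` if the base points differ, a case that never matters). -/
noncomputable def sumMk (a : E.Total) (b : E'.Total) : (E.sum E').Total :=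
  ⟨a.proj, (a.2, if h : b.proj = a.proj then h ▸ b.2 else 0)⟩

theorem sumFst_sumMk (a : E.Total) (b : E'.Total) : sumFst (sumMk a b) = a := rfl

theorem sumSnd_sumMk (a : E.Total) (b : E'.Total) (h : b.proj = a.proj) :
    sumSnd (sumMk a b) = b := by
  obtain ⟨x, v⟩ := a
  obtain ⟨y, w⟩ := b
  obtain rfl : y = x := h
  simp [sumSnd, sumMk]

theorem sum_ext {p q : (E.sum E').Total} (h₁ : sumFst p = sumFst q) (h₂ : sumSnd p = sumSnd q) :
    p = q := by
  obtain ⟨x, v, w⟩ := p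
  obtain ⟨y, v', w'⟩ := q
  obtain rfl : x = y := congrArg TotalSpace.proj h₁
  have h₁' : v = v' := TotalSpace.mk_injective x h₁
  have h₂' : w = w' := TotalSpace.mk_injective x h₂
  rw [h₁', h₂']

theorem contMDiffWithinAt_sum_iff {f : B' → (E.sum E').Total} {s : Set B'} {x : B'} :
    ContMDiffWithinAt I' (E.sum E').totalModel ∞ f s x ↔
      ContMDiffWithinAt I' E.totalModel ∞ (fun y => sumFst (f y)) s x ∧
      ContMDiffWithinAt I' E'.totalModel ∞ (fun y => sumSnd (f y)) s x := by
  have key : ContMDiffWithinAt I' 𝓘(ℝ, (E.sum E').Model) ∞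
      (fun y => (trivializationAt (E.sum E').Model (E.sum E').Fiber (f x).proj (f y)).2) s x ↔
      ContMDiffWithinAt I' 𝓘(ℝ, E.Model) ∞
        (fun y => (trivializationAt E.Model E.Fiber (f x).proj (sumFst (f y))).2) s x ∧
      ContMDiffWithinAt I' 𝓘(ℝ, E'.Model) ∞
        (fun y => (trivializationAt E'.Model E'.Fiber (f x).proj (sumSnd (f y))).2) s x :=
    contMDiffWithinAt_prod_module_iff _
  rw [contMDiffWithinAt_totalSpace, contMDiffWithinAt_totalSpace, contMDiffWithinAt_totalSpace, key]
  exact ⟨fun h => ⟨⟨h.1, h.2.1⟩, h.1, h.2.2⟩, fun h => ⟨h.1.1, h.1.2, h.2.2⟩⟩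

theorem contMDiffOn_sum_iff {f : B' → (E.sum E').Total} {s : Set B'} :
    ContMDiffOn I' (E.sum E').totalModel ∞ f s ↔
      ContMDiffOn I' E.totalModel ∞ (fun y => sumFst (f y)) s ∧
      ContMDiffOn I' E'.totalModel ∞ (fun y => sumSnd (f y)) s :=
  ⟨fun h => ⟨fun x hx => (contMDiffWithinAt_sum_iff.1 (h x hx)).1,
    fun x hx => (contMDiffWithinAt_sum_iff.1 (h x hx)).2⟩,
    fun h x hx => contMDiffWithinAt_sum_iff.2 ⟨h.1 x hx, h.2 x hx⟩⟩

theorem contMDiff_sum_iff {f : B' → (E.sum E').Total} :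
    ContMDiff I' (E.sum E').totalModel ∞ f ↔
      ContMDiff I' E.totalModel ∞ (fun y => sumFst (f y)) ∧
      ContMDiff I' E'.totalModel ∞ (fun y => sumSnd (f y)) := by
  simp only [← contMDiffOn_univ, contMDiffOn_sum_iff]

theorem contMDiff_sumFst :
    ContMDiff (E.sum E').totalModel E.totalModel ∞ (sumFst : (E.sum E').Total → E.Total) :=
  (contMDiff_sum_iff.1 contMDiff_id).1

theorem contMDiff_sumSnd :
    ContMDiff (E.sum E').totalModel E'.totalModel ∞ (sumSnd : (E.sum E').Total → E'.Total) :=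
  (contMDiff_sum_iff.1 contMDiff_id).2

/-- The direct sum of two maps of total spaces covering the same map of the bases. -/
noncomputable def sumMap {F F' : SmoothVectorBundle I' B'} (Φ : E.Total → F.Total)
    (Ψ : E'.Total → F'.Total) (p : (E.sum E').Total) : (F.sum F').Total :=
  sumMk (Φ (sumFst p)) (Ψ (sumSnd p))

variable {F F' : SmoothVectorBundle I' B'} {f : B → B'} {Φ : E.Total → F.Total}
  {Ψ : E'.Total → F'.Total}

theorem IsLinearOver.proj (h : E.IsLinearOver F f Φ) (p : E.Total) : (Φ p).proj = f p.proj := by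
  obtain ⟨L, hL⟩ := h
  rw [← TotalSpace.eta p, hL]

theorem sumFst_sumMap (p : (E.sum E').Total) : sumFst (sumMap Φ Ψ p) = Φ (sumFst p) := rfl

theorem sumSnd_sumMap (hΦ : E.IsLinearOver F f Φ) (hΨ : E'.IsLinearOver F' f Ψ)
    (p : (E.sum E').Total) : sumSnd (sumMap Φ Ψ p) = Ψ (sumSnd p) :=
  sumSnd_sumMk _ _ ((hΨ.proj _).trans (hΦ.proj (sumFst p)).symm)

theorem sumMap_smooth (hΦ : E.IsLinearOver F f Φ) (hΨ : E'.IsLinearOver F' f Ψ)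
    (sΦ : ContMDiff E.totalModel F.totalModel ∞ Φ)
    (sΨ : ContMDiff E'.totalModel F'.totalModel ∞ Ψ) :
    ContMDiff (E.sum E').totalModel (F.sum F').totalModel ∞ (sumMap Φ Ψ) := by
  refine contMDiff_sum_iff.2 ⟨sΦ.comp contMDiff_sumFst, ?_⟩
  simp only [sumSnd_sumMap hΦ hΨ]
  exact sΨ.comp contMDiff_sumSnd

theorem sumMap_apply {L : ∀ b, E.Fiber b →ₗ[ℝ] F.Fiber (f b)}
    {L' : ∀ b, E'.Fiber b →ₗ[ℝ] F'.Fiber (f b)} (hL : ∀ b v, Φ ⟨b, v⟩ = ⟨f b, L b v⟩)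
    (hL' : ∀ b v, Ψ ⟨b, v⟩ = ⟨f b, L' b v⟩) (b : B) (v : (E.sum E').Fiber b) :
    sumMap Φ Ψ ⟨b, v⟩ = ⟨f b, (L b).prodMap (L' b) v⟩ := by
  apply sum_ext
  · exact hL b v.1
  · rw [sumSnd_sumMap ⟨L, hL⟩ ⟨L', hL'⟩]
    exact hL' b v.2

theorem sumMap_linear (hΦ : E.IsLinearOver F f Φ) (hΨ : E'.IsLinearOver F' f Ψ) :
    (E.sum E').IsLinearOver (F.sum F') f (sumMap Φ Ψ) := by
  obtain ⟨L, hL⟩ := hΦ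
  obtain ⟨L', hL'⟩ := hΨ
  exact ⟨fun b => (L b).prodMap (L' b), sumMap_apply hL hL'⟩

theorem sumMap_submersion (hf : IsSmoothSubmersion I I' f) (hΦ : E.IsLinearOver F f Φ)
    (hΨ : E'.IsLinearOver F' f Ψ) (sΦ : IsSmoothSubmersion E.totalModel F.totalModel Φ)
    (sΨ : IsSmoothSubmersion E'.totalModel F'.totalModel Ψ) :
    IsSmoothSubmersion (E.sum E').totalModel (F.sum F').totalModel (sumMap Φ Ψ) := by
  have smooth := sumMap_smooth hΦ hΨ sΦ.contMDiff sΨ.contMDiff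
  obtain ⟨L, hL⟩ := hΦ
  obtain ⟨L', hL'⟩ := hΨ
  refine ⟨smooth, fun p => ?_⟩
  have h₁ := VBAux.bundleMap_fiber_surjective hf.contMDiff sΦ.contMDiff L hL sΦ.mfderiv_surjective
  have h₂ := VBAux.bundleMap_fiber_surjective hf.contMDiff sΨ.contMDiff L' hL' sΨ.mfderiv_surjective
  exact VBAux.bundleMap_mfderiv_surjective hf.contMDiff hf.mfderiv_surjective smooth
    (fun b => (L b).prodMap (L' b)) (sumMap_apply hL hL')
    (fun b => Function.Surjective.prodMap (h₁ b) (h₂ b)) p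

end Sum

end SmoothVectorBundle

/-! ### VB-groupoids over a fixed Lie groupoid -/

section VB

variable {EG HG G EM HM M : Type*}
  [NormedAddCommGroup EG] [NormedSpace ℝ EG] [TopologicalSpace HG]
  [TopologicalSpace G] [ChartedSpace HG G]
  [NormedAddCommGroup EM] [NormedSpace ℝ EM] [TopologicalSpace HM]
  [TopologicalSpace M] [ChartedSpace HM M]
  {IG : ModelWithCorners ℝ EG HG} {IM : ModelWithCorners ℝ EM HM}

/-- A VB-groupoid `Γ ⇉ E` over the Lie groupoid `G ⇉ M`: vector bundles `Γ → G` and `E → M` and a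
Lie groupoid structure on the total spaces such that the bundle projections form a Lie groupoid
morphism and all the structure maps are linear. -/
structure VBGroupoid (𝒢 : LieGroupoid IG G IM M) where
  arr : SmoothVectorBundle.{v} IG G
  obj : SmoothVectorBundle.{v} IM M
  tot : LieGroupoid arr.totalModel arr.Total obj.totalModel obj.Total
  proj_isHom : tot.IsHom 𝒢 TotalSpace.proj TotalSpace.proj
  src_linear : arr.IsLinearOver obj 𝒢.src tot.src
  tgt_linear : arr.IsLinearOver obj 𝒢.tgt tot.tgt
  unit_linear : obj.IsLinearOver arr 𝒢.unit tot.unit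
  inv_linear : arr.IsLinearOver arr 𝒢.inv tot.inv
  /-- Multiplication is linear on the space of composable pairs of vectors over `(g, h)`: if
  `v · w = x` and `v' · w' = x'`, then `(a v + b v') · (a w + b w') = a x + b x'`. -/
  mul_linear : ∀ (g h : G) (v v' : arr.Fiber g) (w w' : arr.Fiber h)
    (x x' : arr.Fiber (𝒢.mul g h)) (a b : ℝ),
    tot.src ⟨g, v⟩ = tot.tgt ⟨h, w⟩ → tot.src ⟨g, v'⟩ = tot.tgt ⟨h, w'⟩ →
    tot.mul ⟨g, v⟩ ⟨h, w⟩ = ⟨𝒢.mul g h, x⟩ → tot.mul ⟨g, v'⟩ ⟨h, w'⟩ = ⟨𝒢.mul g h, x'⟩ →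
    tot.mul ⟨g, a • v + b • v'⟩ ⟨h, a • w + b • w'⟩ = ⟨𝒢.mul g h, a • x + b • x'⟩

namespace VBGroupoid

variable {𝒢 : LieGroupoid IG G IM M}

/-! #### Core and anchor -/

theorem mk_eq_mk_zero {E : SmoothVectorBundle.{v} IM M} {x y : M} (h : y = x) (w : E.Fiber y) :
    (⟨y, w⟩ : E.Total) = ⟨x, 0⟩ ↔ w = 0 := by
  subst h
  exact (TotalSpace.mk_injective y).eq_iff

/-- The fiber over `x` of the core `C = ker (s : Γ → E)|_M`: the vectors over the unit arrow of `x`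
whose source is zero. -/
def core (Γ : VBGroupoid.{v} 𝒢) (x : M) : Submodule ℝ (Γ.arr.Fiber (𝒢.unit x)) where
  carrier := {c | Γ.tot.src ⟨𝒢.unit x, c⟩ = ⟨x, 0⟩}
  zero_mem' := by
    obtain ⟨L, hL⟩ := Γ.src_linear
    simp only [Set.mem_ofPred_eq, hL, mk_eq_mk_zero (𝒢.src_unit x), map_zero]
  add_mem' {c d} hc hd := by
    obtain ⟨L, hL⟩ := Γ.src_linear
    simp only [Set.mem_ofPred_eq, hL, mk_eq_mk_zero (𝒢.src_unit x)] at hc hd ⊢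
    rw [map_add, hc, hd, add_zero]
  smul_mem' a c hc := by
    obtain ⟨L, hL⟩ := Γ.src_linear
    simp only [Set.mem_ofPred_eq, hL, mk_eq_mk_zero (𝒢.src_unit x)] at hc ⊢
    rw [map_smul, hc, smul_zero]

theorem tgt_proj_unit (Γ : VBGroupoid.{v} 𝒢) (x : M) (c : Γ.arr.Fiber (𝒢.unit x)) :
    (Γ.tot.tgt ⟨𝒢.unit x, c⟩).proj = x :=
  (Γ.tgt_linear.proj _).trans (𝒢.tgt_unit x)

/-- The anchor `∂ = t|_C : C → E`, over `x`. -/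
def anchor (Γ : VBGroupoid.{v} 𝒢) (x : M) (c : Γ.core x) : Γ.obj.Fiber x :=
  Γ.tgt_proj_unit x c ▸ (Γ.tot.tgt ⟨𝒢.unit x, c⟩).2

/-- The anchor is the restriction of the target map. -/
theorem mk_anchor (Γ : VBGroupoid.{v} 𝒢) (x : M) (c : Γ.core x) :
    (⟨x, Γ.anchor x c⟩ : Γ.obj.Total) = Γ.tot.tgt ⟨𝒢.unit x, c⟩ := by
  have : ∀ (p : Γ.obj.Total) (h : p.proj = x), (⟨x, h ▸ p.2⟩ : Γ.obj.Total) = p := by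
    rintro p rfl
    rfl
  exact this _ _

/-- A VB-groupoid is acyclic if its anchor is a fiberwise isomorphism. (The anchor is linear, since
the target map is, so that bijectivity is enough.) -/
def IsAcyclic (Γ : VBGroupoid.{v} 𝒢) : Prop :=
  ∀ x, Function.Bijective (Γ.anchor x)

/-! #### VB-maps over the identity of the base groupoid -/

/-- A VB-map `Γ → Γ'` over `G`, that is, covering the identity of `G ⇉ M`. -/
structure Hom (Γ Γ' : VBGroupoid.{v} 𝒢) where
  onArr : Γ.arr.Total → Γ'.arr.Total
  onObj : Γ.obj.Total → Γ'.obj.Total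
  isHom : Γ.tot.IsHom Γ'.tot onArr onObj
  arr_linear : Γ.arr.IsLinearOver Γ'.arr (fun g => g) onArr
  obj_linear : Γ.obj.IsLinearOver Γ'.obj (fun x => x) onObj

namespace Hom

/-- The identity VB-map. -/
def id (Γ : VBGroupoid.{v} 𝒢) : Hom Γ Γ where
  onArr p := p
  onObj p := p
  isHom := LieGroupoid.IsHom.id _
  arr_linear := ⟨fun _ => LinearMap.id, fun _ _ => rfl⟩
  obj_linear := ⟨fun _ => LinearMap.id, fun _ _ => rfl⟩

/-- The composite `ψ ∘ φ` of VB-maps. -/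
def comp {Γ Γ' Γ'' : VBGroupoid.{v} 𝒢} (ψ : Hom Γ' Γ'') (φ : Hom Γ Γ') : Hom Γ Γ'' where
  onArr p := ψ.onArr (φ.onArr p)
  onObj p := ψ.onObj (φ.onObj p)
  isHom := ψ.isHom.comp φ.isHom
  arr_linear := by
    obtain ⟨L, hL⟩ := φ.arr_linear
    obtain ⟨L', hL'⟩ := ψ.arr_linear
    exact ⟨fun b => (L' b).comp (L b), fun b v => by beta_reduce; rw [hL, hL']; rfl⟩
  obj_linear := by
    obtain ⟨L, hL⟩ := φ.obj_linear
    obtain ⟨L', hL'⟩ := ψ.obj_linear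
    exact ⟨fun b => (L' b).comp (L b), fun b v => by beta_reduce; rw [hL, hL']; rfl⟩

/-- An isomorphism `α : φ ≅ ψ` over `G` between VB-maps `Γ' → Γ`: a vector bundle map
`α : E' → Γ|_M` over the identity of `M` (equivalently, a smooth fiberwise linear map `E' → Γ`
covering the unit map `M → G`) with `s α(e) = φ(e)`, `t α(e) = ψ(e)` and
`ψ(v) α(e) = α(e') φ(v)` for every arrow `v : e → e'` of `Γ'`. -/
structure Iso {Γ' Γ : VBGroupoid.{v} 𝒢} (φ ψ : Hom Γ' Γ) where
  α : Γ'.obj.Total → Γ.arr.Total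
  smooth : ContMDiff Γ'.obj.totalModel Γ.arr.totalModel ∞ α
  linear : Γ'.obj.IsLinearOver Γ.arr 𝒢.unit α
  src_α : ∀ e, Γ.tot.src (α e) = φ.onObj e
  tgt_α : ∀ e, Γ.tot.tgt (α e) = ψ.onObj e
  natural : ∀ v, Γ.tot.mul (ψ.onArr v) (α (Γ'.tot.src v)) =
    Γ.tot.mul (α (Γ'.tot.tgt v)) (φ.onArr v)

/-- A VB-map over `G` is an equivalence if it has a quasi-inverse: an inverse up to isomorphisms of
VB-maps over `G`. -/
def IsEquivalence {Γ Γ' : VBGroupoid.{v} 𝒢} (φ : Hom Γ Γ') : Prop :=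
  ∃ ψ : Hom Γ' Γ, Nonempty (Iso (ψ.comp φ) (id Γ)) ∧ Nonempty (Iso (φ.comp ψ) (id Γ'))

end Hom

/-- Two VB-groupoids over `G` are equivalent. -/
def Equivalent (Γ Γ' : VBGroupoid.{v} 𝒢) : Prop :=
  ∃ φ : Hom Γ Γ', φ.IsEquivalence

/-- Two VB-groupoids over `G` are isomorphic: there are mutually inverse VB-maps over `G`. -/
def Isomorphic (Γ Γ' : VBGroupoid.{v} 𝒢) : Prop :=
  ∃ (φ : Hom Γ Γ') (ψ : Hom Γ' Γ), ψ.comp φ = Hom.id Γ ∧ φ.comp ψ = Hom.id Γ'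

/-! #### Direct sums -/

open SmoothVectorBundle

/-- The multiplication of a direct sum: componentwise. -/
noncomputable def sumMul (Γ Ω : VBGroupoid.{v} 𝒢) (p q : (Γ.arr.sum Ω.arr).Total) :
    (Γ.arr.sum Ω.arr).Total :=
  sumMk (Γ.tot.mul (sumFst p) (sumFst q)) (Ω.tot.mul (sumSnd p) (sumSnd q))

section

variable (Γ Ω : VBGroupoid.{v} 𝒢)

theorem sum_src_eq_tgt {p q : (Γ.arr.sum Ω.arr).Total}
    (h : (sumMap Γ.tot.src Ω.tot.src p : (Γ.obj.sum Ω.obj).Total) =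
      sumMap Γ.tot.tgt Ω.tot.tgt q) :
    Γ.tot.src (sumFst p) = Γ.tot.tgt (sumFst q) ∧ Ω.tot.src (sumSnd p) = Ω.tot.tgt (sumSnd q) := by
  refine ⟨congrArg sumFst h, ?_⟩
  have := congrArg sumSnd h
  rwa [sumSnd_sumMap Γ.src_linear Ω.src_linear, sumSnd_sumMap Γ.tgt_linear Ω.tgt_linear] at this

theorem sumSnd_sumMul {p q : (Γ.arr.sum Ω.arr).Total}
    (h₁ : Γ.tot.src (sumFst p) = Γ.tot.tgt (sumFst q))
    (h₂ : Ω.tot.src (sumSnd p) = Ω.tot.tgt (sumSnd q)) :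
    sumSnd (sumMul Γ Ω p q) = Ω.tot.mul (sumSnd p) (sumSnd q) :=
  sumSnd_sumMk _ _
    ((Ω.proj_isHom.map_mul _ _ h₂).trans (Γ.proj_isHom.map_mul _ _ h₁).symm)

end

/-- The Lie groupoid `Γ ⊕ Ω ⇉ E ⊕ F`, with all structure maps componentwise. -/
noncomputable def sumTot (Γ Ω : VBGroupoid.{v} 𝒢) :
    LieGroupoid (Γ.arr.sum Ω.arr).totalModel (Γ.arr.sum Ω.arr).Total
      (Γ.obj.sum Ω.obj).totalModel (Γ.obj.sum Ω.obj).Total :=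
  have S : ∀ p, sumSnd (sumMap Γ.tot.src Ω.tot.src p : (Γ.obj.sum Ω.obj).Total) =
      Ω.tot.src (sumSnd p) := sumSnd_sumMap Γ.src_linear Ω.src_linear
  have T : ∀ p, sumSnd (sumMap Γ.tot.tgt Ω.tot.tgt p : (Γ.obj.sum Ω.obj).Total) =
      Ω.tot.tgt (sumSnd p) := sumSnd_sumMap Γ.tgt_linear Ω.tgt_linear
  have U : ∀ p, sumSnd (sumMap Γ.tot.unit Ω.tot.unit p : (Γ.arr.sum Ω.arr).Total) =
      Ω.tot.unit (sumSnd p) := sumSnd_sumMap Γ.unit_linear Ω.unit_linear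
  have V : ∀ p, sumSnd (sumMap Γ.tot.inv Ω.tot.inv p : (Γ.arr.sum Ω.arr).Total) =
      Ω.tot.inv (sumSnd p) := sumSnd_sumMap Γ.inv_linear Ω.inv_linear
  have su : ∀ x : (Γ.obj.sum Ω.obj).Total,
      (sumMap Γ.tot.src Ω.tot.src
        (sumMap Γ.tot.unit Ω.tot.unit x : (Γ.arr.sum Ω.arr).Total) : (Γ.obj.sum Ω.obj).Total) = x :=
    fun x => sum_ext (Γ.tot.src_unit _) (by rw [S, U, Ω.tot.src_unit])
  have tu : ∀ x : (Γ.obj.sum Ω.obj).Total,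
      (sumMap Γ.tot.tgt Ω.tot.tgt
        (sumMap Γ.tot.unit Ω.tot.unit x : (Γ.arr.sum Ω.arr).Total) : (Γ.obj.sum Ω.obj).Total) = x :=
    fun x => sum_ext (Γ.tot.tgt_unit _) (by rw [T, U, Ω.tot.tgt_unit])
  { src := sumMap Γ.tot.src Ω.tot.src
    tgt := sumMap Γ.tot.tgt Ω.tot.tgt
    unit := sumMap Γ.tot.unit Ω.tot.unit
    inv := sumMap Γ.tot.inv Ω.tot.inv
    mul := sumMul Γ Ω
    src_surjective := fun x => ⟨_, su x⟩
    tgt_surjective := fun x => ⟨_, tu x⟩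
    src_submersion := sumMap_submersion 𝒢.src_submersion Γ.src_linear Ω.src_linear
      Γ.tot.src_submersion Ω.tot.src_submersion
    tgt_submersion := sumMap_submersion 𝒢.tgt_submersion Γ.tgt_linear Ω.tgt_linear
      Γ.tot.tgt_submersion Ω.tot.tgt_submersion
    unit_smooth := sumMap_smooth Γ.unit_linear Ω.unit_linear Γ.tot.unit_smooth Ω.tot.unit_smooth
    inv_smooth := sumMap_smooth Γ.inv_linear Ω.inv_linear Γ.tot.inv_smooth Ω.tot.inv_smooth
    mul_smooth := by
      refine contMDiffOn_sum_iff.2 ⟨?_, ?_⟩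
      · exact Γ.tot.mul_smooth.comp
          (contMDiff_sumFst.prodMap contMDiff_sumFst).contMDiffOn
          (fun p hp => (sum_src_eq_tgt Γ Ω hp).1)
      · refine (Ω.tot.mul_smooth.comp
          (contMDiff_sumSnd.prodMap contMDiff_sumSnd).contMDiffOn
          (fun p hp => (sum_src_eq_tgt Γ Ω hp).2)).congr (fun p hp => ?_)
        have := sum_src_eq_tgt Γ Ω hp
        exact sumSnd_sumMul Γ Ω this.1 this.2
    src_unit := su
    tgt_unit := tu
    src_inv := fun g => sum_ext (Γ.tot.src_inv _) (by rw [S, V, T, Ω.tot.src_inv])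
    tgt_inv := fun g => sum_ext (Γ.tot.tgt_inv _) (by rw [T, V, S, Ω.tot.tgt_inv])
    src_mul := fun g h H => by
      obtain ⟨h₁, h₂⟩ := sum_src_eq_tgt Γ Ω H
      exact sum_ext (Γ.tot.src_mul _ _ h₁)
        (by rw [S, sumSnd_sumMul Γ Ω h₁ h₂, S, Ω.tot.src_mul _ _ h₂])
    tgt_mul := fun g h H => by
      obtain ⟨h₁, h₂⟩ := sum_src_eq_tgt Γ Ω H
      exact sum_ext (Γ.tot.tgt_mul _ _ h₁)
        (by rw [T, sumSnd_sumMul Γ Ω h₁ h₂, T, Ω.tot.tgt_mul _ _ h₂])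
    mul_assoc := fun g h k H K => by
      obtain ⟨h₁, h₂⟩ := sum_src_eq_tgt Γ Ω H
      obtain ⟨k₁, k₂⟩ := sum_src_eq_tgt Γ Ω K
      have l₁ : Γ.tot.src (sumFst (sumMul Γ Ω g h)) = Γ.tot.tgt (sumFst k) :=
        (Γ.tot.src_mul _ _ h₁).trans k₁
      have l₂ : Ω.tot.src (sumSnd (sumMul Γ Ω g h)) = Ω.tot.tgt (sumSnd k) := by
        rw [sumSnd_sumMul Γ Ω h₁ h₂]; exact (Ω.tot.src_mul _ _ h₂).trans k₂
      have m₁ : Γ.tot.src (sumFst g) = Γ.tot.tgt (sumFst (sumMul Γ Ω h k)) :=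
        h₁.trans (Γ.tot.tgt_mul _ _ k₁).symm
      have m₂ : Ω.tot.src (sumSnd g) = Ω.tot.tgt (sumSnd (sumMul Γ Ω h k)) := by
        rw [sumSnd_sumMul Γ Ω k₁ k₂]; exact h₂.trans (Ω.tot.tgt_mul _ _ k₂).symm
      refine sum_ext (Γ.tot.mul_assoc _ _ _ h₁ k₁) ?_
      rw [sumSnd_sumMul Γ Ω l₁ l₂, sumSnd_sumMul Γ Ω m₁ m₂, sumSnd_sumMul Γ Ω h₁ h₂,
        sumSnd_sumMul Γ Ω k₁ k₂, Ω.tot.mul_assoc _ _ _ h₂ k₂]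
    unit_mul := fun g => by
      refine sum_ext (Γ.tot.unit_mul _) ?_
      rw [sumSnd_sumMul Γ Ω (p := sumMap _ _ (sumMap _ _ g)) (q := g) (Γ.tot.src_unit _) (by rw [U, T, Ω.tot.src_unit]), U, T,
        Ω.tot.unit_mul]
    mul_unit := fun g => by
      refine sum_ext (Γ.tot.mul_unit _) ?_
      rw [sumSnd_sumMul Γ Ω (Γ.tot.tgt_unit _).symm (by rw [U, S, Ω.tot.tgt_unit]), U, S,
        Ω.tot.mul_unit]
    inv_mul := fun g => by
      refine sum_ext (Γ.tot.inv_mul _) ?_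
      rw [sumSnd_sumMul Γ Ω (p := sumMap _ _ g) (q := g) (Γ.tot.src_inv _) (by rw [V, Ω.tot.src_inv]), U, V, S, Ω.tot.inv_mul]
    mul_inv := fun g => by
      refine sum_ext (Γ.tot.mul_inv _) ?_
      rw [sumSnd_sumMul Γ Ω (Γ.tot.tgt_inv _).symm (by rw [V, Ω.tot.tgt_inv]), U, V, T,
        Ω.tot.mul_inv] }

theorem src_eq_tgt_linear (Γ : VBGroupoid.{v} 𝒢) {g h : G} {v v' : Γ.arr.Fiber g}
    {w w' : Γ.arr.Fiber h} (H : Γ.tot.src ⟨g, v⟩ = Γ.tot.tgt ⟨h, w⟩)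
    (H' : Γ.tot.src ⟨g, v'⟩ = Γ.tot.tgt ⟨h, w'⟩) (a b : ℝ) :
    Γ.tot.src ⟨g, a • v + b • v'⟩ = Γ.tot.tgt ⟨h, a • w + b • w'⟩ := by
  obtain ⟨L, hL⟩ := Γ.src_linear
  obtain ⟨L', hL'⟩ := Γ.tgt_linear
  simp only [hL, hL', map_add, map_smul] at H H' ⊢
  have aux : ∀ {x y : M} (_ : x = y) {p q : Γ.obj.Fiber x} {r s : Γ.obj.Fiber y},
      (⟨x, p⟩ : Γ.obj.Total) = ⟨y, r⟩ → (⟨x, q⟩ : Γ.obj.Total) = ⟨y, s⟩ →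
      (⟨x, a • p + b • q⟩ : Γ.obj.Total) = ⟨y, a • r + b • s⟩ := by
    rintro x y rfl p q r s h₁ h₂
    have h₁' : p = r := TotalSpace.mk_injective x h₁
    have h₂' : q = s := TotalSpace.mk_injective x h₂
    rw [h₁', h₂']
  exact aux (congrArg TotalSpace.proj H) H H'

/-- The direct sum `Γ ⊕ Ω` of two VB-groupoids over `G`. -/
noncomputable def sum (Γ Ω : VBGroupoid.{v} 𝒢) : VBGroupoid.{v} 𝒢 where
  arr := Γ.arr.sum Ω.arr
  obj := Γ.obj.sum Ω.obj
  tot := Γ.sumTot Ω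
  proj_isHom :=
    { smooth_arr := contMDiff_proj _
      smooth_obj := contMDiff_proj _
      map_src := fun g => Γ.proj_isHom.map_src _
      map_tgt := fun g => Γ.proj_isHom.map_tgt _
      map_unit := fun x => Γ.proj_isHom.map_unit _
      map_inv := fun g => Γ.proj_isHom.map_inv _
      map_mul := fun g h H => Γ.proj_isHom.map_mul _ _ (sum_src_eq_tgt Γ Ω H).1 }
  src_linear := sumMap_linear Γ.src_linear Ω.src_linear
  tgt_linear := sumMap_linear Γ.tgt_linear Ω.tgt_linear
  unit_linear := sumMap_linear Γ.unit_linear Ω.unit_linear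
  inv_linear := sumMap_linear Γ.inv_linear Ω.inv_linear
  mul_linear g h v v' w w' x x' a b H H' X X' := by
    obtain ⟨h₁, h₂⟩ := sum_src_eq_tgt Γ Ω H
    obtain ⟨h₁', h₂'⟩ := sum_src_eq_tgt Γ Ω H'
    have X₂ := congrArg sumSnd X
    have X₂' := congrArg sumSnd X'
    change sumSnd (sumMul Γ Ω _ _) = _ at X₂
    change sumSnd (sumMul Γ Ω _ _) = _ at X₂'
    rw [sumSnd_sumMul Γ Ω h₁ h₂] at X₂
    rw [sumSnd_sumMul Γ Ω h₁' h₂'] at X₂'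
    have r₁ := Γ.mul_linear g h v.1 v'.1 w.1 w'.1 x.1 x'.1 a b h₁ h₁'
      (congrArg sumFst X) (congrArg sumFst X')
    have r₂ := Ω.mul_linear g h v.2 v'.2 w.2 w'.2 x.2 x'.2 a b h₂ h₂' X₂ X₂'
    have c₁ : Γ.tot.src ⟨g, a • v.1 + b • v'.1⟩ = Γ.tot.tgt ⟨h, a • w.1 + b • w'.1⟩ := by
      exact src_eq_tgt_linear Γ h₁ h₁' a b
    have c₂ : Ω.tot.src ⟨g, a • v.2 + b • v'.2⟩ = Ω.tot.tgt ⟨h, a • w.2 + b • w'.2⟩ := by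
      exact src_eq_tgt_linear Ω h₂ h₂' a b
    refine sum_ext r₁ ?_
    exact (sumSnd_sumMul Γ Ω (p := ⟨g, a • v + b • v'⟩) (q := ⟨h, a • w + b • w'⟩) c₁ c₂).trans r₂

end VBGroupoid

end VB

/-! Acyclic VB-groupoids are the contractible ones: a vector over a given arrow is determined by its
source and target, and these can be prescribed freely (`IsAcyclic.arr_unique`,
`IsAcyclic.exists_arr`). The basic example is `pair 𝒢 E`, that is, `s^* E ⊕ t^* E ⇉ E`.

If `Ω` is acyclic, the inclusion of `Γ` into `Γ ⊕ Ω` and the projection back are quasi-inverse. One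
composite is the identity; the other is isomorphic to it through `(e, e') ↦ (1_e, a(e'))`, where `a`
inverts the anchor (`IsAcyclic.inl_fst_iso`). Hence VB-groupoids that are isomorphic after adding
acyclic summands are equivalent.

Conversely, let `φ : Γ → Γ'` have the quasi-inverse `ψ`, with `β : φψ ≅ id`. Then `φ` is fully
faithful, and it suffices to stabilize it to a fully faithful map that is bijective on objects,
since such a map is bijective on arrows and a bijective VB-map is an isomorphism. On `Γ ⊕ pair E'`
the arrow `τ(u, w) = β(w) + 1_{φ(u)} - 1_{φψ(w)}` goes from `φ(u)` to `w + φ(u) - φψ(w)`.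
Conjugating the projection followed by `φ` with `τ` gives a fully faithful map to `Γ'` with this new
effect on objects. Adding the component `u - ψ(w)` into `pair E` gives a map to `Γ' ⊕ pair E`, still
fully faithful because the new summand is acyclic. On objects it is the block matrix `[[φ, 1 - φψ],
[1, -ψ]]`, whose inverse is `[[ψ, 1 - ψφ], [1, -φ]]` for any linear `φ` and `ψ`.

Smoothness of inverses comes from `contMDiff_of_comp_injective`: fiberwise injective smooth bundle
maps detect smoothness. -/

namespace SmoothVectorBundle

variable {EB HB B EB' HB' B' EN HN N : Type*}
  [NormedAddCommGroup EB] [NormedSpace ℝ EB] [TopologicalSpace HB]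
  [TopologicalSpace B] [ChartedSpace HB B]
  [NormedAddCommGroup EB'] [NormedSpace ℝ EB'] [TopologicalSpace HB']
  [TopologicalSpace B'] [ChartedSpace HB' B']
  [NormedAddCommGroup EN] [NormedSpace ℝ EN] [TopologicalSpace HN]
  [TopologicalSpace N] [ChartedSpace HN N]
  {I : ModelWithCorners ℝ EB HB} {I' : ModelWithCorners ℝ EB' HB'} {J : ModelWithCorners ℝ EN HN}

/-! ### Smooth maps into vector bundles -/

/-- A family of linear maps on a finite-dimensional space is smooth if it is smooth on vectors. -/
theorem contMDiffAt_clm_of_apply {F F' : Type*} [NormedAddCommGroup F] [NormedSpace ℝ F]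
    [FiniteDimensional ℝ F] [NormedAddCommGroup F'] [NormedSpace ℝ F'] {A : N → F →L[ℝ] F'} {x : N}
    (h : ∀ v, ContMDiffAt J 𝓘(ℝ, F') ∞ (fun n => A n v) x) :
    ContMDiffAt J 𝓘(ℝ, F →L[ℝ] F') ∞ A x := by
  let b := Module.finBasis ℝ F
  -- Expansion in a basis: `A n` is the sum of the rank-one maps built from the coordinate
  -- functionals and the vectors `A n (b i)`.
  have hA : A = fun n => ∑ i, ContinuousLinearMap.smulRightL ℝ F F'
      (LinearMap.toContinuousLinearMap (b.coord i)) (A n (b i)) := by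
    funext n
    ext v
    conv_lhs => rw [← b.sum_repr v, map_sum]
    simp
  rw [hA]
  refine ContMDiffAt.sum fun i _ => ?_
  exact (ContinuousLinearMap.contMDiff _).contMDiffAt.comp x (h (b i))

/-- A map into a vector bundle is smooth if it becomes smooth after composition with the projection
and with a smooth fiberwise linear map that is injective on fibers. -/
theorem contMDiff_of_comp_injective {E : SmoothVectorBundle I B} {E' : SmoothVectorBundle I' B'}
    {f : B → B'} (hf : ContMDiff I I' ∞ f) {Φ : E.Total → E'.Total}
    (hΦ : ContMDiff E.totalModel E'.totalModel ∞ Φ) (hlin : E.IsLinearOver E' f Φ)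
    (hinj : ∀ p q, p.proj = q.proj → Φ p = Φ q → p = q) {a : N → E.Total}
    (ha : ContMDiff J I ∞ fun n => (a n).proj)
    (hΦa : ContMDiff J E'.totalModel ∞ fun n => Φ (a n)) :
    ContMDiff J E.totalModel ∞ a := by
  intro n₀
  obtain ⟨L, hL⟩ := hlin
  refine contMDiffAt_totalSpace.2 ⟨ha n₀, ?_⟩
  set g := (a n₀).proj with hg
  set e := trivializationAt E.Model E.Fiber g with he
  set φ := trivializationAt E'.Model E'.Fiber (f g) with hφ
  have hge : g ∈ e.baseSet := mem_baseSet_trivializationAt _ _ g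
  have hgφ : f g ∈ φ.baseSet := mem_baseSet_trivializationAt _ _ (f g)
  -- The matrix of `Φ` over `b` in the trivializations around `g` and `f g`.
  let A : B → E.Model →L[ℝ] E'.Model := fun b =>
    LinearMap.toContinuousLinearMap ((φ.linearMapAt ℝ (f b)) ∘ₗ L b ∘ₗ e.symmₗ ℝ b)
  have hA : ∀ b ∈ e.baseSet, f b ∈ φ.baseSet → ∀ c, A b c = (φ (Φ ⟨b, e.symm b c⟩)).2 := by
    intro b hb hfb c
    simp only [A, hL, LinearMap.coe_toContinuousLinearMap', LinearMap.comp_apply]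
    rw [φ.coe_linearMapAt_of_mem hfb, e.symmₗ_apply hb]
  have hev : ∀ᶠ b in 𝓝 g, b ∈ e.baseSet ∧ f b ∈ φ.baseSet :=
    Filter.Eventually.and (e.open_baseSet.mem_nhds hge)
      (hf.continuous.continuousAt.preimage_mem_nhds (φ.open_baseSet.mem_nhds hgφ))
  have hAs : ContMDiffAt I 𝓘(ℝ, E.Model →L[ℝ] E'.Model) ∞ A g := by
    refine contMDiffAt_clm_of_apply fun c => ?_
    have h1 : ContMDiffAt I E.totalModel ∞
        (fun b => e.toOpenPartialHomeomorph.symm (b, c)) g := by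
      have hmem : (g, c) ∈ e.target := by rw [e.mem_target]; exact hge
      have := (e.contMDiffOn_symm (IB := I) (n := ∞)).contMDiffAt (e.open_target.mem_nhds hmem)
      exact this.comp g (contMDiffAt_id.prodMk contMDiffAt_const)
    have h2 : e.toOpenPartialHomeomorph.symm (g, c) = ⟨g, e.symm g c⟩ := (e.mk_symm hge c).symm
    have h3 : φ.source ∈ 𝓝 (Φ (e.toOpenPartialHomeomorph.symm (g, c))) := by
      refine φ.open_source.mem_nhds ?_
      rw [h2, hL, φ.mem_source]
      exact hgφ
    have h4 := (((φ.contMDiffOn (IB := I') (n := ∞)).contMDiffAt h3).snd).comp g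
      ((hΦ _).comp g h1)
    refine h4.congr_of_eventuallyEq ?_
    filter_upwards [hev] with b hb
    rw [hA b hb.1 hb.2]
    simp only [Function.comp]
    rw [← e.mk_symm hb.1 c]
  have hAinj : Function.Injective (A g) := by
    intro c c' h
    rw [hA g hge hgφ, hA g hge hgφ] at h
    have h' : Φ ⟨g, e.symm g c⟩ = Φ ⟨g, e.symm g c'⟩ := by
      refine φ.injOn ?_ ?_ (Prod.ext ?_ h)
      · rw [hL, φ.mem_source]; exact hgφ
      · rw [hL, φ.mem_source]; exact hgφ
      · exact (φ.coe_fst' (by rw [hL]; exact hgφ)).trans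
          ((by rw [hL, hL] : (Φ ⟨g, e.symm g c⟩).proj = (Φ ⟨g, e.symm g c'⟩).proj).trans
            (φ.coe_fst' (by rw [hL]; exact hgφ)).symm)
    have h'' := hinj ⟨g, e.symm g c⟩ ⟨g, e.symm g c'⟩ rfl h'
    have h3 := congrArg (fun p => (e p).2) h''
    simpa [e.apply_mk_symm hge] using h3
  -- A left inverse is chosen at the single point `g`. The endomorphism `P ∘ A b` is the identity at
  -- `b = g`, hence invertible for `b` near `g`, with an inverse that depends smoothly on `b`.
  obtain ⟨P, hP⟩ := (A g : E.Model →ₗ[ℝ] E'.Model).exists_leftInverse_of_injective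
    (LinearMap.ker_eq_bot.2 hAinj)
  let P' : E'.Model →L[ℝ] E.Model := LinearMap.toContinuousLinearMap P
  have hPA : P'.comp (A g) = ContinuousLinearMap.id ℝ E.Model := by
    ext c
    exact LinearMap.congr_fun hP c
  let Q : B → E.Model →L[ℝ] E.Model := fun b => P'.comp (A b)
  have hQ : ContMDiffAt I 𝓘(ℝ, E.Model →L[ℝ] E.Model) ∞ Q g := contMDiffAt_const.clm_comp hAs
  have hQg : Q g = ((ContinuousLinearEquiv.refl ℝ E.Model : E.Model ≃L[ℝ] E.Model) :
      E.Model →L[ℝ] E.Model) := hPA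
  have : CompleteSpace E.Model := FiniteDimensional.complete ℝ _
  have hQi : ContMDiffAt I 𝓘(ℝ, E.Model →L[ℝ] E.Model) ∞
      (fun b => ContinuousLinearMap.inverse (Q b)) g := by
    have := contDiffAt_map_inverse (𝕜 := ℝ) (n := ∞) (ContinuousLinearEquiv.refl ℝ E.Model)
    rw [← hQg] at this
    exact this.contMDiffAt.comp g hQ
  have hΦφ : φ.source ∈ 𝓝 (Φ (a n₀)) := by
    refine φ.open_source.mem_nhds ?_
    rw [← TotalSpace.eta (a n₀), hL, φ.mem_source]
    exact hgφ
  have hu : ContMDiffAt J 𝓘(ℝ, E'.Model) ∞ (fun n => (φ (Φ (a n))).2) n₀ :=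
    ContMDiffAt.comp n₀ (g := fun p => (φ p).2) (f := fun n => Φ (a n))
      ((φ.contMDiffOn (IB := I') (n := ∞)).contMDiffAt hΦφ).snd (hΦa n₀)
  -- The fiber coordinate of `a n` is recovered as `Q⁻¹ P` applied to the fiber coordinate of `Φ (a
  -- n)`.
  have hres : ContMDiffAt J 𝓘(ℝ, E.Model) ∞
      (fun n => ContinuousLinearMap.inverse (Q (a n).proj) (P' (φ (Φ (a n))).2)) n₀ :=
    (ContMDiffAt.comp n₀ (g := fun b => ContinuousLinearMap.inverse (Q b))
      (f := fun n => (a n).proj) hQi (ha n₀)).clm_apply (contMDiffAt_const.clm_apply hu)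
  refine hres.congr_of_eventuallyEq ?_
  have hQev : ∀ᶠ b in 𝓝 g, (Q b).IsInvertible := by
    have h1 := ContinuousLinearEquiv.nhds (ContinuousLinearEquiv.refl ℝ E.Model)
    rw [← hQg] at h1
    exact hQ.continuousAt.preimage_mem_nhds h1
  filter_upwards [(ha n₀).continuousAt.eventually (hev.and hQev)] with n hn
  obtain ⟨⟨hn1, hn2⟩, hn3⟩ := hn
  symm
  have h5 : A (a n).proj (e (a n)).2 = (φ (Φ (a n))).2 := by
    rw [hA _ hn1 hn2]
    have : (⟨(a n).proj, e.symm (a n).proj (e (a n)).2⟩ : E.Total) = a n := by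
      rw [e.mk_symm hn1]
      exact e.symm_apply_mk_proj (e.mem_source.2 hn1)
    rw [this]
  rw [← h5]
  exact hn3.inverse_apply_self _

/-- Fiberwise linear combinations of smooth maps into a vector bundle are smooth. -/
theorem contMDiff_add_smul {E : SmoothVectorBundle I B} {f : N → B}
    {u v : ∀ n, E.Fiber (f n)} (r : ℝ) (hf : ContMDiff J I ∞ f)
    (hu : ContMDiff J E.totalModel ∞ fun n => (⟨f n, u n⟩ : E.Total))
    (hv : ContMDiff J E.totalModel ∞ fun n => (⟨f n, v n⟩ : E.Total)) :
    ContMDiff J E.totalModel ∞ fun n => (⟨f n, u n + r • v n⟩ : E.Total) := by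
  intro n₀
  refine contMDiffAt_totalSpace.2 ⟨hf n₀, ?_⟩
  have h1 := (contMDiffAt_totalSpace.1 (hu n₀)).2
  have h2 := (contMDiffAt_totalSpace.1 (hv n₀)).2
  refine (h1.add ((contMDiffAt_const (c := r • ContinuousLinearMap.id ℝ E.Model)).clm_apply h2)).congr_of_eventuallyEq ?_
  filter_upwards [(hf n₀).continuousAt.preimage_mem_nhds
    ((trivializationAt E.Model E.Fiber (f n₀)).open_baseSet.mem_nhds
      (mem_baseSet_trivializationAt _ _ (f n₀)))] with n hn
  have hl := (trivializationAt E.Model E.Fiber (f n₀)).linear ℝ hn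
  simp [hl.map_add, hl.map_smul]

/-! ### Pullback bundles -/

/-- The pullback of a vector bundle along a smooth map. -/
noncomputable def pullback (E : SmoothVectorBundle.{v} I' B') (f : ContMDiffMap I I' B B' ∞) :
    SmoothVectorBundle.{v} I B where
  Model := E.Model
  Fiber := f *ᵖ E.Fiber
  addCommGroup b := inferInstanceAs (AddCommGroup (E.Fiber (f b)))
  module b := inferInstanceAs (Module ℝ (E.Fiber (f b)))

section

variable {E : SmoothVectorBundle.{v} I' B'} {f : ContMDiffMap I I' B B' ∞}

/-- The tautological map from a pullback bundle to the original bundle. -/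
noncomputable def pullbackLift (p : (E.pullback f).Total) : E.Total := ⟨f p.1, p.2⟩

/-- The trivialization of the pullback at `x` is that of `E` at `f x`, so the fiber coordinates on
the two sides coincide and only the conditions on base points differ. -/
theorem contMDiffOn_pullback_iff {h : N → (E.pullback f).Total} {s : Set N} :
    ContMDiffOn J (E.pullback f).totalModel ∞ h s ↔
      ContMDiffOn J I ∞ (fun n => (h n).proj) s ∧
      ContMDiffOn J E.totalModel ∞ (fun n => pullbackLift (h n)) s := by
  have key : ∀ n, ContMDiffWithinAt J (E.pullback f).totalModel ∞ h s n ↔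
      ContMDiffWithinAt J I ∞ (fun n => (h n).proj) s n ∧
      ContMDiffWithinAt J E.totalModel ∞ (fun n => pullbackLift (h n)) s n := by
    intro n
    rw [contMDiffWithinAt_totalSpace, contMDiffWithinAt_totalSpace]
    exact ⟨fun H => ⟨H.1, f.contMDiff.contMDiffAt.comp_contMDiffWithinAt n H.1, H.2⟩,
      fun H => ⟨H.1, H.2.2⟩⟩
  exact ⟨fun H => ⟨fun n hn => ((key n).1 (H n hn)).1, fun n hn => ((key n).1 (H n hn)).2⟩,
    fun H n hn => (key n).2 ⟨H.1 n hn, H.2 n hn⟩⟩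

end

/-! ### Fiberwise linear combinations as a relation on total spaces -/

/-- `r` is the linear combination `a p + b q` of the vectors `p` and `q` in one fiber. -/
def IsComb {E : SmoothVectorBundle I B} (a b : ℝ) (p q r : E.Total) : Prop :=
  ∃ (x : B) (u v : E.Fiber x), p = ⟨x, u⟩ ∧ q = ⟨x, v⟩ ∧ r = ⟨x, a • u + b • v⟩

section

variable {E : SmoothVectorBundle I B} {E' : SmoothVectorBundle I' B'}

theorem isComb_mk (a b : ℝ) {x : B} (u v : E.Fiber x) :
    IsComb a b (⟨x, u⟩ : E.Total) ⟨x, v⟩ ⟨x, a • u + b • v⟩ :=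
  ⟨x, u, v, rfl, rfl, rfl⟩

theorem isComb_mk_iff {a b : ℝ} {x : B} {u v w : E.Fiber x} :
    IsComb a b (⟨x, u⟩ : E.Total) ⟨x, v⟩ ⟨x, w⟩ ↔ w = a • u + b • v := by
  constructor
  · rintro ⟨y, u', v', h₁, h₂, h₃⟩
    obtain rfl : x = y := congrArg TotalSpace.proj h₁
    rw [TotalSpace.mk_injective x h₁, TotalSpace.mk_injective x h₂, TotalSpace.mk_injective x h₃]
  · rintro rfl
    exact isComb_mk a b u v

theorem IsComb.proj_left {a b : ℝ} {p q r : E.Total} (h : IsComb a b p q r) : p.proj = r.proj := by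
  obtain ⟨x, u, v, rfl, rfl, rfl⟩ := h
  rfl

theorem IsComb.proj_right {a b : ℝ} {p q r : E.Total} (h : IsComb a b p q r) : q.proj = r.proj := by
  obtain ⟨x, u, v, rfl, rfl, rfl⟩ := h
  rfl

/-- Two vectors are shown equal by exhibiting both as the same combination. Base points are thereby
compared inside the total space, which avoids transport between fibers over points that are only
provably equal. -/
theorem IsComb.unique {a b : ℝ} {p q r r' : E.Total} (h : IsComb a b p q r)
    (h' : IsComb a b p q r') : r = r' := by
  obtain ⟨x, u, v, rfl, rfl, rfl⟩ := h
  obtain ⟨y, w⟩ := r'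
  obtain rfl : x = y := h'.proj_left
  rw [isComb_mk_iff.1 h']

theorem IsLinearOver.isComb {f : B → B'} {Φ : E.Total → E'.Total} (hΦ : E.IsLinearOver E' f Φ)
    {a b : ℝ} {p q r : E.Total} (h : IsComb a b p q r) : IsComb a b (Φ p) (Φ q) (Φ r) := by
  obtain ⟨L, hL⟩ := hΦ
  obtain ⟨x, u, v, rfl, rfl, rfl⟩ := h
  rw [hL, hL, hL, map_add, map_smul, map_smul]
  exact isComb_mk _ _ _ _

/-- The vector `p`, regarded as an element of the fiber over `x` (junk if it is not over `x`). -/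
noncomputable def toFiber (x : B) (p : E.Total) : E.Fiber x :=
  open Classical in if h : p.proj = x then h ▸ p.2 else 0

theorem mk_toFiber {x : B} {p : E.Total} (h : p.proj = x) : (⟨x, toFiber x p⟩ : E.Total) = p := by
  subst h
  simp [toFiber]

/-- Coefficients `(1, 1)` give additivity and `(a, 0)` gives homogeneity; `toFiber` extracts the
fiber maps. -/
theorem isLinearOver_of_isComb {f : B → B'} {Φ : E.Total → E'.Total}
    (hp : ∀ p, (Φ p).proj = f p.proj)
    (hΦ : ∀ (a b : ℝ) (p q r : E.Total), IsComb a b p q r → IsComb a b (Φ p) (Φ q) (Φ r)) :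
    E.IsLinearOver E' f Φ := by
  have key : ∀ (x : B) (a b : ℝ) (u v : E.Fiber x), toFiber (f x) (Φ ⟨x, a • u + b • v⟩) =
      a • toFiber (f x) (Φ ⟨x, u⟩) + b • toFiber (f x) (Φ ⟨x, v⟩) := by
    intro x a b u v
    rw [← isComb_mk_iff, mk_toFiber (hp ⟨x, u⟩), mk_toFiber (hp ⟨x, v⟩),
      mk_toFiber (hp ⟨x, a • u + b • v⟩)]
    exact hΦ _ _ _ _ _ (isComb_mk a b u v)
  refine ⟨fun x => ⟨⟨fun u => toFiber (f x) (Φ ⟨x, u⟩), fun u v => ?_⟩, fun a u => ?_⟩,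
    fun x u => (mk_toFiber (hp _)).symm⟩
  · simpa using key x 1 1 u v
  · simpa using key x a 0 u 0

/-- A fiberwise linear combination of two smooth fiberwise linear maps. -/
theorem exists_isComb_map {f : B → B'} (hf : ContMDiff I I' ∞ f) {Φ Ψ : E.Total → E'.Total}
    (r : ℝ) (hΦ : E.IsLinearOver E' f Φ) (hΨ : E.IsLinearOver E' f Ψ)
    (sΦ : ContMDiff E.totalModel E'.totalModel ∞ Φ)
    (sΨ : ContMDiff E.totalModel E'.totalModel ∞ Ψ) :
    ∃ Θ : E.Total → E'.Total, ContMDiff E.totalModel E'.totalModel ∞ Θ ∧ E.IsLinearOver E' f Θ ∧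
      ∀ p, IsComb 1 r (Φ p) (Ψ p) (Θ p) := by
  obtain ⟨L, hL⟩ := hΦ
  obtain ⟨L', hL'⟩ := hΨ
  refine ⟨fun p => ⟨f p.proj, L p.proj p.2 + r • L' p.proj p.2⟩, ?_,
    ⟨fun x => L x + r • L' x, fun _ _ => rfl⟩, ?_⟩
  · refine contMDiff_add_smul r (hf.comp (contMDiff_proj _)) (sΦ.congr fun p => ?_)
      (sΨ.congr fun p => ?_)
    · exact (hL p.proj p.2).symm
    · exact (hL' p.proj p.2).symm
  · rintro ⟨x, u⟩
    rw [hL, hL', isComb_mk_iff, one_smul]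

theorem IsLinearOver.zero {f : B → B'} :
    E.IsLinearOver E' f (fun p => zeroSection E'.Model E'.Fiber (f p.proj)) :=
  ⟨fun _ => 0, fun _ _ => rfl⟩

theorem IsLinearOver.comp {EB'' HB'' B'' : Type*} [NormedAddCommGroup EB''] [NormedSpace ℝ EB'']
    [TopologicalSpace HB''] [TopologicalSpace B''] [ChartedSpace HB'' B'']
    {I'' : ModelWithCorners ℝ EB'' HB''} {E'' : SmoothVectorBundle I'' B''} {f : B → B'}
    {f' : B' → B''} {f'' : B → B''} {Φ : E.Total → E'.Total} {Ψ : E'.Total → E''.Total}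
    (hΨ : E'.IsLinearOver E'' f' Ψ) (hΦ : E.IsLinearOver E' f Φ) (h : ∀ x, f' (f x) = f'' x) :
    E.IsLinearOver E'' f'' (fun p => Ψ (Φ p)) :=
  isLinearOver_of_isComb (fun p => by rw [hΨ.proj, hΦ.proj, h])
    fun _ _ _ _ _ H => hΨ.isComb (hΦ.isComb H)

end

section

variable {E E' : SmoothVectorBundle I B}

theorem sumFst_linear : (E.sum E').IsLinearOver E (fun x => x) sumFst :=
  ⟨fun x => LinearMap.fst ℝ (E.Fiber x) (E'.Fiber x), fun _ _ => rfl⟩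

theorem sumSnd_linear : (E.sum E').IsLinearOver E' (fun x => x) sumSnd :=
  ⟨fun x => LinearMap.snd ℝ (E.Fiber x) (E'.Fiber x), fun _ _ => rfl⟩

theorem isComb_sum_iff {a b : ℝ} {p q r : (E.sum E').Total} :
    IsComb a b p q r ↔ IsComb a b (sumFst p) (sumFst q) (sumFst r) ∧
      IsComb a b (sumSnd p) (sumSnd q) (sumSnd r) := by
  refine ⟨fun h => ⟨sumFst_linear.isComb h, sumSnd_linear.isComb h⟩, ?_⟩
  rintro ⟨h₁, h₂⟩
  obtain ⟨x, u⟩ := p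
  obtain ⟨y, v⟩ := q
  obtain ⟨z, w⟩ := r
  obtain rfl : x = z := h₁.proj_left
  obtain rfl : y = x := h₁.proj_right
  exact isComb_mk_iff.2 (Prod.ext (isComb_mk_iff.1 h₁) (isComb_mk_iff.1 h₂))

theorem sumMk_linear {F : SmoothVectorBundle I' B'} {f : B' → B} {Φ : F.Total → E.Total}
    {Ψ : F.Total → E'.Total} (hΦ : F.IsLinearOver E f Φ) (hΨ : F.IsLinearOver E' f Ψ) :
    F.IsLinearOver (E.sum E') f (fun p => sumMk (Φ p) (Ψ p)) := by
  have h : ∀ p, (Ψ p).proj = (Φ p).proj := fun p => (hΨ.proj p).trans (hΦ.proj p).symm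
  refine isLinearOver_of_isComb hΦ.proj fun a b p q r H => isComb_sum_iff.2 ⟨hΦ.isComb H, ?_⟩
  rw [sumSnd_sumMk _ _ (h p), sumSnd_sumMk _ _ (h q), sumSnd_sumMk _ _ (h r)]
  exact hΨ.isComb H

theorem contMDiff_sumMk {Φ : B' → E.Total}
    {Ψ : B' → E'.Total} (h : ∀ p, (Ψ p).proj = (Φ p).proj)
    (sΦ : ContMDiff I' E.totalModel ∞ Φ) (sΨ : ContMDiff I' E'.totalModel ∞ Ψ) :
    ContMDiff I' (E.sum E').totalModel ∞ (fun p => sumMk (Φ p) (Ψ p)) :=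
  contMDiff_sum_iff.2 ⟨sΦ, sΨ.congr fun p => sumSnd_sumMk _ _ (h p)⟩

end

end SmoothVectorBundle

/-! ### The acyclic VB-groupoid of pairs `s^* E ⊕ t^* E ⇉ E` -/

section VB

variable {EG HG G EM HM M : Type*}
  [NormedAddCommGroup EG] [NormedSpace ℝ EG] [TopologicalSpace HG]
  [TopologicalSpace G] [ChartedSpace HG G]
  [NormedAddCommGroup EM] [NormedSpace ℝ EM] [TopologicalSpace HM]
  [TopologicalSpace M] [ChartedSpace HM M]
  {IG : ModelWithCorners ℝ EG HG} {IM : ModelWithCorners ℝ EM HM}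

open SmoothVectorBundle

namespace LieGroupoid

/-- The vector bundle `s^* E ⊕ t^* E` over the manifold of arrows. -/
noncomputable def pairBundle (𝒢 : LieGroupoid IG G IM M) (E : SmoothVectorBundle.{v} IM M) :
    SmoothVectorBundle.{v} IG G :=
  (E.pullback ⟨𝒢.src, 𝒢.src_submersion.contMDiff⟩).sum
    (E.pullback ⟨𝒢.tgt, 𝒢.tgt_submersion.contMDiff⟩)

variable {𝒢 : LieGroupoid IG G IM M} {E : SmoothVectorBundle.{v} IM M}

noncomputable def pairSrc (p : (𝒢.pairBundle E).Total) : E.Total := pullbackLift (sumFst p)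

noncomputable def pairTgt (p : (𝒢.pairBundle E).Total) : E.Total := pullbackLift (sumSnd p)

/-- The element of `s^* E ⊕ t^* E` over the arrow `g` with components `p` and `q`. -/
noncomputable def pairMk (𝒢 : LieGroupoid IG G IM M) {E : SmoothVectorBundle.{v} IM M} (g : G)
    (p q : E.Total) : (𝒢.pairBundle E).Total :=
  ⟨g, (toFiber (𝒢.src g) p, toFiber (𝒢.tgt g) q)⟩

theorem pairSrc_pairMk {g : G} {p : E.Total} (q : E.Total) (h : p.proj = 𝒢.src g) :
    pairSrc (𝒢.pairMk g p q) = p := mk_toFiber h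

theorem pairTgt_pairMk {g : G} (p : E.Total) {q : E.Total} (h : q.proj = 𝒢.tgt g) :
    pairTgt (𝒢.pairMk g p q) = q := mk_toFiber h

/-- Arrows of the pair groupoid carry no data beyond base arrow, source and target, so each groupoid
law reduces to the same law in `𝒢` and two identities of endpoints. -/
theorem pair_ext {p q : (𝒢.pairBundle E).Total} (h : p.proj = q.proj)
    (hs : pairSrc p = pairSrc q) (ht : pairTgt p = pairTgt q) : p = q := by
  obtain ⟨g, a, b⟩ := p
  obtain ⟨g', a', b'⟩ := q
  obtain rfl : g = g' := h
  have h₁ : a = a' := TotalSpace.mk_injective (𝒢.src g) hs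
  have h₂ : b = b' := TotalSpace.mk_injective (𝒢.tgt g) ht
  rw [h₁, h₂]

theorem pairSrc_linear : (𝒢.pairBundle E).IsLinearOver E 𝒢.src pairSrc :=
  ⟨fun g => LinearMap.fst ℝ (E.Fiber (𝒢.src g)) (E.Fiber (𝒢.tgt g)), fun _ _ => rfl⟩

theorem pairTgt_linear : (𝒢.pairBundle E).IsLinearOver E 𝒢.tgt pairTgt :=
  ⟨fun g => LinearMap.snd ℝ (E.Fiber (𝒢.src g)) (E.Fiber (𝒢.tgt g)), fun _ _ => rfl⟩

theorem isComb_pair {a b : ℝ} {p q r : (𝒢.pairBundle E).Total} (hp : p.proj = r.proj)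
    (hq : q.proj = r.proj) (hs : IsComb a b (pairSrc p) (pairSrc q) (pairSrc r))
    (ht : IsComb a b (pairTgt p) (pairTgt q) (pairTgt r)) : IsComb a b p q r := by
  obtain ⟨g, u⟩ := p
  obtain ⟨g', v⟩ := q
  obtain ⟨g'', w⟩ := r
  obtain rfl : g = g'' := hp
  obtain rfl : g' = g := hq
  exact isComb_mk_iff.2 (Prod.ext (isComb_mk_iff (E := E).1 hs) (isComb_mk_iff (E := E).1 ht))

theorem contMDiffOn_pair_iff {EN HN N : Type*} [NormedAddCommGroup EN] [NormedSpace ℝ EN]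
    [TopologicalSpace HN] [TopologicalSpace N] [ChartedSpace HN N] {J : ModelWithCorners ℝ EN HN}
    {s : Set N} {h : N → (𝒢.pairBundle E).Total} :
    ContMDiffOn J (𝒢.pairBundle E).totalModel ∞ h s ↔
      ContMDiffOn J IG ∞ (fun n => (h n).proj) s ∧
      ContMDiffOn J E.totalModel ∞ (fun n => pairSrc (h n)) s ∧
      ContMDiffOn J E.totalModel ∞ (fun n => pairTgt (h n)) s := by
  refine (contMDiffOn_sum_iff.trans
    (and_congr contMDiffOn_pullback_iff contMDiffOn_pullback_iff)).trans ?_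
  exact ⟨fun H => ⟨H.1.1, H.1.2, H.2.2⟩, fun H => ⟨⟨H.1, H.2.1⟩, H.1, H.2.2⟩⟩

theorem contMDiff_pairSrc : ContMDiff (𝒢.pairBundle E).totalModel E.totalModel ∞
    (pairSrc : (𝒢.pairBundle E).Total → E.Total) :=
  contMDiffOn_univ.1 (contMDiffOn_pair_iff.1 contMDiffOn_id).2.1

theorem contMDiff_pairTgt : ContMDiff (𝒢.pairBundle E).totalModel E.totalModel ∞
    (pairTgt : (𝒢.pairBundle E).Total → E.Total) :=
  contMDiffOn_univ.1 (contMDiffOn_pair_iff.1 contMDiffOn_id).2.2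

theorem contMDiff_pair {EN HN N : Type*} [NormedAddCommGroup EN] [NormedSpace ℝ EN]
    [TopologicalSpace HN] [TopologicalSpace N] [ChartedSpace HN N] {J : ModelWithCorners ℝ EN HN}
    {h : N → (𝒢.pairBundle E).Total} (h₁ : ContMDiff J IG ∞ (fun n => (h n).proj))
    (h₂ : ContMDiff J E.totalModel ∞ (fun n => pairSrc (h n)))
    (h₃ : ContMDiff J E.totalModel ∞ (fun n => pairTgt (h n))) :
    ContMDiff J (𝒢.pairBundle E).totalModel ∞ h :=
  contMDiffOn_univ.1 (contMDiffOn_pair_iff.2 ⟨h₁.contMDiffOn, h₂.contMDiffOn, h₃.contMDiffOn⟩)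

end LieGroupoid

open LieGroupoid

/-- The Lie groupoid `s^* E ⊕ t^* E ⇉ E`, with one arrow over each `g` from each vector over the
source of `g` to each vector over its target. -/
noncomputable def LieGroupoid.pairTot (𝒢 : LieGroupoid IG G IM M) (E : SmoothVectorBundle.{v} IM M) :
    LieGroupoid (𝒢.pairBundle E).totalModel (𝒢.pairBundle E).Total E.totalModel E.Total :=
  -- These base-point identities ensure that the vectors given to `pairMk` lie over the right
  -- points, so that the junk value of `toFiber` never occurs.
  have hU : ∀ x : E.Total, x.proj = 𝒢.src (𝒢.unit x.proj) ∧ x.proj = 𝒢.tgt (𝒢.unit x.proj) :=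
    fun x => ⟨(𝒢.src_unit _).symm, (𝒢.tgt_unit _).symm⟩
  have hI : ∀ p : (𝒢.pairBundle E).Total, (pairTgt p).proj = 𝒢.src (𝒢.inv p.proj) ∧
      (pairSrc p).proj = 𝒢.tgt (𝒢.inv p.proj) :=
    fun p => ⟨(𝒢.src_inv _).symm, (𝒢.tgt_inv _).symm⟩
  have hC : ∀ p q : (𝒢.pairBundle E).Total, pairSrc p = pairTgt q →
      𝒢.src p.proj = 𝒢.tgt q.proj := fun p q h => congrArg TotalSpace.proj h
  have hM : ∀ p q : (𝒢.pairBundle E).Total, pairSrc p = pairTgt q →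
      (pairSrc q).proj = 𝒢.src (𝒢.mul p.proj q.proj) ∧
      (pairTgt p).proj = 𝒢.tgt (𝒢.mul p.proj q.proj) :=
    fun p q h => ⟨(𝒢.src_mul _ _ (hC p q h)).symm, (𝒢.tgt_mul _ _ (hC p q h)).symm⟩
  have su : ∀ x : E.Total, pairSrc (𝒢.pairMk (𝒢.unit x.proj) x x) = x :=
    fun x => pairSrc_pairMk _ (hU x).1
  have tu : ∀ x : E.Total, pairTgt (𝒢.pairMk (𝒢.unit x.proj) x x) = x :=
    fun x => pairTgt_pairMk _ (hU x).2
  have si : ∀ p : (𝒢.pairBundle E).Total,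
      pairSrc (𝒢.pairMk (𝒢.inv p.proj) (pairTgt p) (pairSrc p)) = pairTgt p :=
    fun p => pairSrc_pairMk _ (hI p).1
  have ti : ∀ p : (𝒢.pairBundle E).Total,
      pairTgt (𝒢.pairMk (𝒢.inv p.proj) (pairTgt p) (pairSrc p)) = pairSrc p :=
    fun p => pairTgt_pairMk _ (hI p).2
  have sm : ∀ p q : (𝒢.pairBundle E).Total, pairSrc p = pairTgt q →
      pairSrc (𝒢.pairMk (𝒢.mul p.proj q.proj) (pairSrc q) (pairTgt p)) = pairSrc q :=
    fun p q h => pairSrc_pairMk _ (hM p q h).1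
  have tm : ∀ p q : (𝒢.pairBundle E).Total, pairSrc p = pairTgt q →
      pairTgt (𝒢.pairMk (𝒢.mul p.proj q.proj) (pairSrc q) (pairTgt p)) = pairTgt p :=
    fun p q h => pairTgt_pairMk _ (hM p q h).2
  { src := pairSrc
    tgt := pairTgt
    unit := fun x => 𝒢.pairMk (𝒢.unit x.proj) x x
    inv := fun p => 𝒢.pairMk (𝒢.inv p.proj) (pairTgt p) (pairSrc p)
    mul := fun p q => 𝒢.pairMk (𝒢.mul p.proj q.proj) (pairSrc q) (pairTgt p)
    src_surjective := fun x => ⟨_, su x⟩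
    tgt_surjective := fun x => ⟨_, tu x⟩
    src_submersion := ⟨contMDiff_pairSrc, VBAux.bundleMap_mfderiv_surjective
      𝒢.src_submersion.contMDiff 𝒢.src_submersion.mfderiv_surjective contMDiff_pairSrc
      (fun g => LinearMap.fst ℝ (E.Fiber (𝒢.src g)) (E.Fiber (𝒢.tgt g))) (fun _ _ => rfl)
      (fun _ => LinearMap.fst_surjective)⟩
    tgt_submersion := ⟨contMDiff_pairTgt, VBAux.bundleMap_mfderiv_surjective
      𝒢.tgt_submersion.contMDiff 𝒢.tgt_submersion.mfderiv_surjective contMDiff_pairTgt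
      (fun g => LinearMap.snd ℝ (E.Fiber (𝒢.src g)) (E.Fiber (𝒢.tgt g))) (fun _ _ => rfl)
      (fun _ => LinearMap.snd_surjective)⟩
    unit_smooth := contMDiff_pair (𝒢.unit_smooth.comp (contMDiff_proj _))
      (contMDiff_id.congr su) (contMDiff_id.congr tu)
    inv_smooth := contMDiff_pair (𝒢.inv_smooth.comp (contMDiff_proj _))
      (contMDiff_pairTgt.congr si) (contMDiff_pairSrc.congr ti)
    mul_smooth := by
      refine contMDiffOn_pair_iff.2 ⟨?_, ?_, ?_⟩
      · exact 𝒢.mul_smooth.comp ((contMDiff_proj _).prodMap (contMDiff_proj _)).contMDiffOn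
          (fun p hp => hC _ _ hp)
      · exact (contMDiff_pairSrc.comp contMDiff_snd).contMDiffOn.congr fun p hp => sm _ _ hp
      · exact (contMDiff_pairTgt.comp contMDiff_fst).contMDiffOn.congr fun p hp => tm _ _ hp
    src_unit := su
    tgt_unit := tu
    src_inv := si
    tgt_inv := ti
    src_mul := sm
    tgt_mul := tm
    mul_assoc := fun p q r h k => by
      have l : pairSrc (𝒢.pairMk (𝒢.mul p.proj q.proj) (pairSrc q) (pairTgt p)) = pairTgt r :=
        (sm p q h).trans k
      have m : pairSrc p = pairTgt (𝒢.pairMk (𝒢.mul q.proj r.proj) (pairSrc r) (pairTgt q)) :=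
        h.trans (tm q r k).symm
      refine pair_ext (𝒢.mul_assoc _ _ _ (hC _ _ h) (hC _ _ k)) ?_ ?_
      · rw [sm _ _ l, sm _ _ m, sm _ _ k]
      · rw [tm _ _ l, tm _ _ m, tm _ _ h]
    unit_mul := fun p => pair_ext (𝒢.unit_mul _) (sm _ _ (su _)) ((tm _ _ (su _)).trans (tu _))
    mul_unit := fun p => pair_ext (𝒢.mul_unit _) ((sm _ _ (tu _).symm).trans (su _))
      (tm _ _ (tu _).symm)
    inv_mul := fun p => pair_ext (𝒢.inv_mul _) ((sm _ _ (si p)).trans (su _).symm)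
      ((tm _ _ (si p)).trans ((ti p).trans (tu _).symm))
    mul_inv := fun p => pair_ext (𝒢.mul_inv _)
      ((sm _ _ (ti p).symm).trans ((si p).trans (su _).symm))
      ((tm _ _ (ti p).symm).trans (tu _).symm) }

namespace VBGroupoid

variable {𝒢 : LieGroupoid IG G IM M}

/-- The VB-groupoid `s^* E ⊕ t^* E ⇉ E`. -/
noncomputable def pair (𝒢 : LieGroupoid IG G IM M) (E : SmoothVectorBundle.{v} IM M) :
    VBGroupoid.{v} 𝒢 where
  arr := 𝒢.pairBundle E
  obj := E
  tot := 𝒢.pairTot E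
  proj_isHom :=
    { smooth_arr := contMDiff_proj _
      smooth_obj := contMDiff_proj _
      map_src := fun _ => rfl
      map_tgt := fun _ => rfl
      map_unit := fun _ => rfl
      map_inv := fun _ => rfl
      map_mul := fun _ _ _ => rfl }
  src_linear := pairSrc_linear
  tgt_linear := pairTgt_linear
  unit_linear := isLinearOver_of_isComb (fun _ => rfl) fun a b p q r h => by
    refine isComb_pair (congrArg 𝒢.unit h.proj_left) (congrArg 𝒢.unit h.proj_right) ?_ ?_
    · have := (𝒢.pairTot E).src_unit
      change ∀ x, pairSrc ((𝒢.pairTot E).unit x) = x at this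
      rwa [this, this, this]
    · have := (𝒢.pairTot E).tgt_unit
      change ∀ x, pairTgt ((𝒢.pairTot E).unit x) = x at this
      rwa [this, this, this]
  inv_linear := isLinearOver_of_isComb (fun _ => rfl) fun a b p q r h => by
    refine isComb_pair (congrArg 𝒢.inv h.proj_left) (congrArg 𝒢.inv h.proj_right) ?_ ?_
    · have := (𝒢.pairTot E).src_inv
      change ∀ x, pairSrc ((𝒢.pairTot E).inv x) = pairTgt x at this
      rw [this, this, this]
      exact pairTgt_linear.isComb h
    · have := (𝒢.pairTot E).tgt_inv
      change ∀ x, pairTgt ((𝒢.pairTot E).inv x) = pairSrc x at this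
      rw [this, this, this]
      exact pairSrc_linear.isComb h
  mul_linear g h v v' w w' x x' a b H H' X X' := by
    have HH : pairSrc (⟨g, a • v + b • v'⟩ : (𝒢.pairBundle E).Total) =
        pairTgt ⟨h, a • w + b • w'⟩ := by
      have h₁ := pairSrc_linear.isComb (isComb_mk (E := 𝒢.pairBundle E) a b v v')
      have h₂ := pairTgt_linear.isComb (isComb_mk (E := 𝒢.pairBundle E) a b w w')
      change pairSrc _ = pairTgt _ at H H'
      rw [H, H'] at h₁
      exact h₁.unique h₂
    -- The product of the combinations is compared with the combination of the products on source
    -- and target components, where multiplication keeps the source of the second factor and the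
    -- target of the first.
    refine IsComb.unique (a := a) (b := b) (p := ⟨𝒢.mul g h, x⟩) (q := ⟨𝒢.mul g h, x'⟩) ?_
      (isComb_mk a b x x')
    refine isComb_pair rfl rfl ?_ ?_
    · have := (𝒢.pairTot E).src_mul
      change ∀ p q, pairSrc p = pairTgt q → pairSrc ((𝒢.pairTot E).mul p q) = pairSrc q at this
      rw [← X, ← X', this _ _ H, this _ _ H', this _ _ HH]
      exact pairSrc_linear.isComb (isComb_mk a b w w')
    · have := (𝒢.pairTot E).tgt_mul
      change ∀ p q, pairSrc p = pairTgt q → pairTgt ((𝒢.pairTot E).mul p q) = pairTgt p at this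
      rw [← X, ← X', this _ _ H, this _ _ H', this _ _ HH]
      exact pairTgt_linear.isComb (isComb_mk a b v v')

/-- The core over `x` is `0 ⊕ E_x`, and the anchor is its projection to `E_x`. -/
theorem pair_isAcyclic (𝒢 : LieGroupoid IG G IM M) (E : SmoothVectorBundle.{v} IM M) :
    (pair 𝒢 E).IsAcyclic := by
  intro x
  constructor
  · intro c d h
    have h' := congrArg (fun e => (⟨x, e⟩ : E.Total)) h
    beta_reduce at h'
    have hc := mk_anchor (pair 𝒢 E) x c
    have hd := mk_anchor (pair 𝒢 E) x d
    have : (⟨𝒢.unit x, c.1⟩ : (𝒢.pairBundle E).Total) = ⟨𝒢.unit x, d.1⟩ :=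
      pair_ext rfl (c.2.trans d.2.symm) (hc.symm.trans (h'.trans hd))
    exact Subtype.ext (TotalSpace.mk_injective _ this)
  · intro e
    refine ⟨⟨(𝒢.pairMk (𝒢.unit x) (⟨x, 0⟩ : E.Total) ⟨x, e⟩).2,
      pairSrc_pairMk _ (𝒢.src_unit x).symm⟩, ?_⟩
    refine TotalSpace.mk_injective x ((mk_anchor (pair 𝒢 E) x _).trans ?_)
    exact pairTgt_pairMk _ (𝒢.tgt_unit x).symm

end VBGroupoid

end VB

/-! ### Cancellation laws in Lie groupoids -/

namespace LieGroupoid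

variable {EG HG G EM HM M : Type*}
  [NormedAddCommGroup EG] [NormedSpace ℝ EG] [TopologicalSpace HG]
  [TopologicalSpace G] [ChartedSpace HG G]
  [NormedAddCommGroup EM] [NormedSpace ℝ EM] [TopologicalSpace HM]
  [TopologicalSpace M] [ChartedSpace HM M]
  {IG : ModelWithCorners ℝ EG HG} {IM : ModelWithCorners ℝ EM HM}
  (A : LieGroupoid IG G IM M)

theorem contMDiff_mul {EN HN N : Type*} [NormedAddCommGroup EN] [NormedSpace ℝ EN]
    [TopologicalSpace HN] [TopologicalSpace N] [ChartedSpace HN N] {J : ModelWithCorners ℝ EN HN}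
    {f h : N → G} (hf : ContMDiff J IG ∞ f) (hh : ContMDiff J IG ∞ h)
    (H : ∀ n, A.src (f n) = A.tgt (h n)) : ContMDiff J IG ∞ (fun n => A.mul (f n) (h n)) :=
  A.mul_smooth.comp_contMDiff (hf.prodMk hh) H

variable {A}

theorem mul_inv_cancel_right {g h : G} (H : A.src g = A.tgt h) :
    A.mul (A.mul g h) (A.inv h) = g := by
  rw [A.mul_assoc _ _ _ H (A.tgt_inv h).symm, A.mul_inv, ← H, A.mul_unit]

theorem inv_mul_cancel_right {g h : G} (H : A.src g = A.src h) :
    A.mul (A.mul g (A.inv h)) h = g := by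
  rw [A.mul_assoc _ _ _ (H.trans (A.tgt_inv h).symm) (A.src_inv h), A.inv_mul, ← H, A.mul_unit]

theorem inv_mul_cancel_left {g h : G} (H : A.src g = A.tgt h) :
    A.mul (A.inv g) (A.mul g h) = h := by
  rw [← A.mul_assoc _ _ _ (A.src_inv g) H, A.inv_mul, H, A.unit_mul]

theorem mul_inv_cancel_left {g h : G} (H : A.tgt g = A.tgt h) :
    A.mul g (A.mul (A.inv g) h) = h := by
  rw [← A.mul_assoc _ _ _ (A.tgt_inv g).symm ((A.src_inv g).trans H), A.mul_inv, H, A.unit_mul]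

theorem mul_right_cancel {g g' h : G} (H : A.src g = A.tgt h) (H' : A.src g' = A.tgt h)
    (h' : A.mul g h = A.mul g' h) : g = g' := by
  rw [← mul_inv_cancel_right H, h', mul_inv_cancel_right H']

theorem mul_left_cancel {g h h' : G} (H : A.src g = A.tgt h) (H' : A.src g = A.tgt h')
    (h'' : A.mul g h = A.mul g h') : h = h' := by
  rw [← inv_mul_cancel_left H, h'', inv_mul_cancel_left H']

theorem inv_eq_of_mul {g h : G} (H : A.src g = A.tgt h) (h' : A.mul g h = A.unit (A.tgt g)) :
    A.inv g = h := by
  rw [← inv_mul_cancel_left H, h', ← A.src_inv g, A.mul_unit]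

theorem inv_unit (x : M) : A.inv (A.unit x) = A.unit x := by
  refine inv_eq_of_mul (by rw [A.src_unit, A.tgt_unit]) ?_
  have := A.mul_unit (A.unit x)
  rw [A.src_unit] at this
  rw [this, A.tgt_unit]

/-- A pair of smooth maps compatible with source, target, units and products is a morphism. -/
theorem isHom_of_mul {EG' HG' G' EM' HM' M' : Type*}
    [NormedAddCommGroup EG'] [NormedSpace ℝ EG'] [TopologicalSpace HG']
    [TopologicalSpace G'] [ChartedSpace HG' G']
    [NormedAddCommGroup EM'] [NormedSpace ℝ EM'] [TopologicalSpace HM']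
    [TopologicalSpace M'] [ChartedSpace HM' M']
    {IG' : ModelWithCorners ℝ EG' HG'} {IM' : ModelWithCorners ℝ EM' HM'}
    {A' : LieGroupoid IG' G' IM' M'} {φ₁ : G → G'} {φ₀ : M → M'}
    (s₁ : ContMDiff IG IG' ∞ φ₁) (s₀ : ContMDiff IM IM' ∞ φ₀)
    (hs : ∀ g, φ₀ (A.src g) = A'.src (φ₁ g)) (ht : ∀ g, φ₀ (A.tgt g) = A'.tgt (φ₁ g))
    (hu : ∀ x, φ₁ (A.unit x) = A'.unit (φ₀ x))
    (hm : ∀ g h, A.src g = A.tgt h → φ₁ (A.mul g h) = A'.mul (φ₁ g) (φ₁ h)) :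
    A.IsHom A' φ₁ φ₀ where
  smooth_arr := s₁
  smooth_obj := s₀
  map_src := hs
  map_tgt := ht
  map_unit := hu
  map_inv g := by
    -- Inverses are preserved because they are unique: the image of `g * inv g` is a unit.
    refine (inv_eq_of_mul ?_ ?_).symm
    · rw [← hs, ← ht, A.tgt_inv]
    · rw [← hm _ _ (A.tgt_inv g).symm, A.mul_inv, hu, ht]
  map_mul := hm

end LieGroupoid

/-! ### Properties of VB-maps -/

section VB

variable {EG HG G EM HM M : Type*}
  [NormedAddCommGroup EG] [NormedSpace ℝ EG] [TopologicalSpace HG]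
  [TopologicalSpace G] [ChartedSpace HG G]
  [NormedAddCommGroup EM] [NormedSpace ℝ EM] [TopologicalSpace HM]
  [TopologicalSpace M] [ChartedSpace HM M]
  {IG : ModelWithCorners ℝ EG HG} {IM : ModelWithCorners ℝ EM HM}

open SmoothVectorBundle LieGroupoid

namespace VBGroupoid

variable {𝒢 : LieGroupoid IG G IM M} {Γ Γ' Γ'' Ω Ω' : VBGroupoid.{v} 𝒢}

theorem proj_mul {p q : Γ.arr.Total} (h : Γ.tot.src p = Γ.tot.tgt q) :
    (Γ.tot.mul p q).proj = 𝒢.mul p.proj q.proj := Γ.proj_isHom.map_mul _ _ h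

/-- The relational form of `mul_linear`, which can be iterated along composite arrows without naming
the fiber over each product. -/
theorem mul_isComb {a b : ℝ} {p p' p'' q q' q'' : Γ.arr.Total} (hp : IsComb a b p p' p'')
    (hq : IsComb a b q q' q'') (h : Γ.tot.src p = Γ.tot.tgt q)
    (h' : Γ.tot.src p' = Γ.tot.tgt q') :
    IsComb a b (Γ.tot.mul p q) (Γ.tot.mul p' q') (Γ.tot.mul p'' q'') := by
  obtain ⟨g, u, u', rfl, rfl, rfl⟩ := hp
  obtain ⟨k, w, w', rfl, rfl, rfl⟩ := hq
  have h₁ := mk_toFiber (E := Γ.arr) (proj_mul h)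
  have h₂ := mk_toFiber (E := Γ.arr) (proj_mul h')
  rw [Γ.mul_linear g k u u' w w' _ _ a b h h' h₁.symm h₂.symm]
  have h₃ := isComb_mk (E := Γ.arr) a b (toFiber (𝒢.mul g k) (Γ.tot.mul ⟨g, u⟩ ⟨k, w⟩))
    (toFiber (𝒢.mul g k) (Γ.tot.mul ⟨g, u'⟩ ⟨k, w'⟩))
  rwa [h₁, h₂] at h₃

namespace Hom

theorem ext {φ ψ : Hom Γ Γ'} (h₁ : φ.onArr = ψ.onArr) (h₀ : φ.onObj = ψ.onObj) : φ = ψ := by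
  cases φ
  cases ψ
  cases h₁
  cases h₀
  rfl

theorem proj_onArr (φ : Hom Γ Γ') (p : Γ.arr.Total) : (φ.onArr p).proj = p.proj :=
  φ.arr_linear.proj p

theorem proj_onObj (φ : Hom Γ Γ') (p : Γ.obj.Total) : (φ.onObj p).proj = p.proj :=
  φ.obj_linear.proj p

/-! #### Fully faithful VB-maps -/

/-- A VB-map is fully faithful if every arrow between images of vectors lifts uniquely to an arrow
between these vectors. -/
structure FullyFaithful (φ : Hom Γ Γ') : Prop where
  faithful : ∀ v w, Γ.tot.src v = Γ.tot.src w → Γ.tot.tgt v = Γ.tot.tgt w →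
    φ.onArr v = φ.onArr w → v = w
  full : ∀ e e' w, Γ'.tot.src w = φ.onObj e → Γ'.tot.tgt w = φ.onObj e' →
    ∃ v, Γ.tot.src v = e ∧ Γ.tot.tgt v = e' ∧ φ.onArr v = w

theorem FullyFaithful.id : (Hom.id Γ).FullyFaithful :=
  ⟨fun _ _ _ _ h => h, fun _ _ w h h' => ⟨w, h, h', rfl⟩⟩

theorem FullyFaithful.comp {ψ : Hom Γ' Γ''} {φ : Hom Γ Γ'} (hψ : ψ.FullyFaithful)
    (hφ : φ.FullyFaithful) : (ψ.comp φ).FullyFaithful where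
  faithful v w hs ht h := hφ.faithful v w hs ht (hψ.faithful _ _
    (by rw [← φ.isHom.map_src, ← φ.isHom.map_src, hs])
    (by rw [← φ.isHom.map_tgt, ← φ.isHom.map_tgt, ht]) h)
  full e e' w hs ht := by
    obtain ⟨u, hu, hu', rfl⟩ := hψ.full _ _ w hs ht
    obtain ⟨v, hv, hv', rfl⟩ := hφ.full _ _ u hu hu'
    exact ⟨v, hv, hv', rfl⟩

/-- Faithfulness of `ψ` recognizes a lift of `ψ(w)` through `ψφ` as a lift of `w` through `φ`. -/
theorem FullyFaithful.of_comp {ψ : Hom Γ' Γ''} {φ : Hom Γ Γ'} (h : (ψ.comp φ).FullyFaithful)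
    (hψ : ∀ v w, Γ'.tot.src v = Γ'.tot.src w → Γ'.tot.tgt v = Γ'.tot.tgt w →
      ψ.onArr v = ψ.onArr w → v = w) : φ.FullyFaithful where
  faithful v w hs ht H := h.faithful v w hs ht (congrArg ψ.onArr H)
  full e e' w hs ht := by
    obtain ⟨v, hv, hv', H⟩ := h.full e e' (ψ.onArr w)
      (by rw [← ψ.isHom.map_src, hs]; rfl) (by rw [← ψ.isHom.map_tgt, ht]; rfl)
    exact ⟨v, hv, hv', hψ _ _ (by rw [← φ.isHom.map_src, hv, hs])
      (by rw [← φ.isHom.map_tgt, hv', ht]) H⟩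

theorem Iso.src_α_eq_tgt {φ ψ : Hom Γ Γ'} (θ : Iso φ ψ) (v : Γ.arr.Total) :
    Γ'.tot.src (θ.α (Γ.tot.tgt v)) = Γ'.tot.tgt (φ.onArr v) := by
  rw [θ.src_α, φ.isHom.map_tgt]

theorem Iso.src_eq_tgt_α {φ ψ : Hom Γ Γ'} (θ : Iso φ ψ) (v : Γ.arr.Total) :
    Γ'.tot.src (ψ.onArr v) = Γ'.tot.tgt (θ.α (Γ.tot.src v)) := by
  rw [θ.tgt_α, ψ.isHom.map_src]

/-- By naturality `ψ(v) = θ(e') φ(v) θ(e)⁻¹`, and conjugation by `θ` is a bijection on arrows with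
given endpoints. -/
theorem FullyFaithful.of_iso {φ ψ : Hom Γ Γ'} (θ : Iso φ ψ) (h : φ.FullyFaithful) :
    ψ.FullyFaithful where
  faithful v w hs ht H := by
    refine h.faithful v w hs ht (mul_left_cancel (θ.src_α_eq_tgt v)
      (by rw [ht]; exact θ.src_α_eq_tgt w) ?_)
    rw [← θ.natural, H, hs, θ.natural, ht]
  full e e' w hs ht := by
    have h₁ : Γ'.tot.src w = Γ'.tot.tgt (θ.α e) := by rw [hs, θ.tgt_α]
    have h₂ : Γ'.tot.src (Γ'.tot.inv (θ.α e')) = Γ'.tot.tgt (Γ'.tot.mul w (θ.α e)) := by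
      rw [Γ'.tot.tgt_mul _ _ h₁, Γ'.tot.src_inv, θ.tgt_α, ht]
    -- The arrow to be lifted through `φ` is `θ(e')⁻¹ w θ(e)`.
    obtain ⟨v, rfl, rfl, hv⟩ := h.full e e' (Γ'.tot.mul (Γ'.tot.inv (θ.α e')) (Γ'.tot.mul w (θ.α e)))
      (by rw [Γ'.tot.src_mul _ _ h₂, Γ'.tot.src_mul _ _ h₁, θ.src_α])
      (by rw [Γ'.tot.tgt_mul _ _ h₂, Γ'.tot.tgt_inv, θ.src_α])
    refine ⟨v, rfl, rfl, mul_right_cancel (θ.src_eq_tgt_α v) h₁ ?_⟩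
    rw [θ.natural, hv, LieGroupoid.mul_inv_cancel_left]
    rw [← h₂, Γ'.tot.src_inv]

/-- The inverse of an isomorphism of VB-maps. -/
noncomputable def Iso.symm {φ ψ : Hom Γ Γ'} (θ : Iso φ ψ) : Iso ψ φ where
  α e := Γ'.tot.inv (θ.α e)
  smooth := Γ'.tot.inv_smooth.comp θ.smooth
  linear := isLinearOver_of_isComb
    (fun p => by rw [Γ'.inv_linear.proj, θ.linear.proj, inv_unit])
    fun _ _ _ _ _ h => Γ'.inv_linear.isComb (θ.linear.isComb h)
  src_α e := by rw [Γ'.tot.src_inv, θ.tgt_α]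
  tgt_α e := by rw [Γ'.tot.tgt_inv, θ.src_α]
  natural v := by
    have h₁ : Γ'.tot.src (φ.onArr v) = Γ'.tot.src (θ.α (Γ.tot.src v)) := by
      rw [θ.src_α, φ.isHom.map_src]
    have h₂ : Γ'.tot.src (φ.onArr v) = Γ'.tot.tgt (Γ'.tot.inv (θ.α (Γ.tot.src v))) := by
      rw [h₁, Γ'.tot.tgt_inv]
    have h₃ : Γ'.tot.src (Γ'.tot.inv (θ.α (Γ.tot.tgt v))) = Γ'.tot.tgt (ψ.onArr v) := by
      rw [Γ'.tot.src_inv, θ.tgt_α, ψ.isHom.map_tgt]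
    -- After right multiplication by `θ(s v)` both sides become `φ(v)`, by naturality of `θ`.
    refine LieGroupoid.mul_right_cancel (A := Γ'.tot) (h := θ.α (Γ.tot.src v)) ?_ ?_ ?_
    · rw [Γ'.tot.src_mul _ _ h₂, Γ'.tot.src_inv]
    · rw [Γ'.tot.src_mul _ _ h₃, θ.src_eq_tgt_α]
    · rw [inv_mul_cancel_right h₁, Γ'.tot.mul_assoc _ _ _ h₃ (θ.src_eq_tgt_α v), θ.natural,
        inv_mul_cancel_left (θ.src_α_eq_tgt v)]

/-- Whiskering of an isomorphism of VB-maps on both sides. -/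
def Iso.whisker {Γ₁ Γ₂ : VBGroupoid.{v} 𝒢} {φ ψ : Hom Γ Γ'} (θ : Iso φ ψ) (κ : Hom Γ' Γ₂)
    (μ : Hom Γ₁ Γ) : Iso (κ.comp (φ.comp μ)) (κ.comp (ψ.comp μ)) where
  α e := κ.onArr (θ.α (μ.onObj e))
  smooth := κ.isHom.smooth_arr.comp (θ.smooth.comp μ.isHom.smooth_obj)
  linear := κ.arr_linear.comp (θ.linear.comp μ.obj_linear fun _ => rfl) fun _ => rfl
  src_α e := by rw [← κ.isHom.map_src, θ.src_α]; rfl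
  tgt_α e := by rw [← κ.isHom.map_tgt, θ.tgt_α]; rfl
  natural v := by
    change Γ₂.tot.mul (κ.onArr (ψ.onArr (μ.onArr v))) _ =
      Γ₂.tot.mul _ (κ.onArr (φ.onArr (μ.onArr v)))
    rw [μ.isHom.map_src, μ.isHom.map_tgt, ← κ.isHom.map_mul _ _ (θ.src_eq_tgt_α _),
      ← κ.isHom.map_mul _ _ (θ.src_α_eq_tgt _), θ.natural]

/-- Both composites are isomorphic to identities, hence fully faithful. Faithfulness of `φψ` makes
`ψ` faithful, and then `φ` inherits full faithfulness from `ψφ`. -/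
theorem IsEquivalence.fullyFaithful {φ : Hom Γ Γ'} (h : φ.IsEquivalence) : φ.FullyFaithful := by
  obtain ⟨ψ, ⟨α⟩, ⟨β⟩⟩ := h
  have h₁ : (ψ.comp φ).FullyFaithful := FullyFaithful.id.of_iso α.symm
  have h₂ : (φ.comp ψ).FullyFaithful := FullyFaithful.id.of_iso β.symm
  exact h₁.of_comp fun v w hs ht H => h₂.faithful v w hs ht (congrArg φ.onArr H)

/-- Bijectivity on objects lets the endpoints of an arrow be pulled back uniquely; full faithfulness
does the rest. -/
theorem FullyFaithful.onArr_bijective {φ : Hom Γ Γ'} (h : φ.FullyFaithful)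
    (h₀ : Function.Bijective φ.onObj) : Function.Bijective φ.onArr := by
  constructor
  · intro v w H
    refine h.faithful v w (h₀.1 ?_) (h₀.1 ?_) H
    · rw [φ.isHom.map_src, H, φ.isHom.map_src]
    · rw [φ.isHom.map_tgt, H, φ.isHom.map_tgt]
  · intro w
    obtain ⟨e, he⟩ := h₀.2 (Γ'.tot.src w)
    obtain ⟨e', he'⟩ := h₀.2 (Γ'.tot.tgt w)
    obtain ⟨v, -, -, hv⟩ := h.full e e' w he.symm he'.symm
    exact ⟨v, hv⟩

end Hom

open Hom

/-! ### Bijective VB-maps are isomorphisms -/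

/-- A right inverse of a smooth fiberwise linear injective map over the identity is smooth and
linear. -/
theorem _root_.SmoothVectorBundle.rightInverse_smooth_linear {EB HB B : Type*}
    [NormedAddCommGroup EB] [NormedSpace ℝ EB] [TopologicalSpace HB]
    [TopologicalSpace B] [ChartedSpace HB B] {I : ModelWithCorners ℝ EB HB}
    {E E' : SmoothVectorBundle I B} {Φ : E.Total → E'.Total} {Ψ : E'.Total → E.Total}
    (sΦ : ContMDiff E.totalModel E'.totalModel ∞ Φ) (hΦ : E.IsLinearOver E' (fun x => x) Φ)
    (hinj : Function.Injective Φ) (hΨ : ∀ p, Φ (Ψ p) = p) :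
    ContMDiff E'.totalModel E.totalModel ∞ Ψ ∧ E'.IsLinearOver E (fun x => x) Ψ := by
  have hp : ∀ p, (Ψ p).proj = p.proj := fun p => by rw [← hΦ.proj (Ψ p), hΨ]
  -- `Φ` is injective on fibers and `Φ ∘ Ψ` is the identity, so `Φ` detects the smoothness of `Ψ`.
  refine ⟨contMDiff_of_comp_injective contMDiff_id sΦ hΦ (fun _ _ _ h => hinj h)
    ((contMDiff_proj _).congr hp) (contMDiff_id.congr hΨ), isLinearOver_of_isComb hp ?_⟩
  intro a b p q r h
  obtain ⟨x, u, v, rfl, rfl, rfl⟩ := h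
  have h₁ := mk_toFiber (hp ⟨x, u⟩)
  have h₂ := mk_toFiber (hp ⟨x, v⟩)
  -- The combination of `Ψ p` and `Ψ q` is mapped by `Φ` to the combination of `p` and `q`, so by
  -- injectivity it is `Ψ r`.
  have h := isComb_mk a b (toFiber x (Ψ ⟨x, u⟩)) (toFiber x (Ψ ⟨x, v⟩))
  rw [h₁, h₂] at h
  have h' := hΦ.isComb h
  rw [hΨ, hΨ] at h'
  have h₃ := h'.unique (isComb_mk a b u v)
  rwa [hinj (h₃.trans (hΨ _).symm)] at h

/-- The set-theoretic inverses are smooth and linear by `rightInverse_smooth_linear`; their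
compatibility with the structure maps is tested after applying the injective `φ`. -/
theorem isomorphic_of_bijective (φ : Hom Γ Γ') (h₁ : Function.Bijective φ.onArr)
    (h₀ : Function.Bijective φ.onObj) : Γ.Isomorphic Γ' := by
  obtain ⟨ψ₁, l₁, r₁⟩ := Function.bijective_iff_has_inverse.1 h₁
  obtain ⟨ψ₀, l₀, r₀⟩ := Function.bijective_iff_has_inverse.1 h₀
  obtain ⟨s₁, lin₁⟩ := rightInverse_smooth_linear φ.isHom.smooth_arr φ.arr_linear h₁.1 r₁
  obtain ⟨s₀, lin₀⟩ := rightInverse_smooth_linear φ.isHom.smooth_obj φ.obj_linear h₀.1 r₀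
  have hs : ∀ g, ψ₀ (Γ'.tot.src g) = Γ.tot.src (ψ₁ g) := fun g => h₀.1 (by
    rw [r₀, φ.isHom.map_src, r₁])
  have ht : ∀ g, ψ₀ (Γ'.tot.tgt g) = Γ.tot.tgt (ψ₁ g) := fun g => h₀.1 (by
    rw [r₀, φ.isHom.map_tgt, r₁])
  refine ⟨φ, ⟨ψ₁, ψ₀, ⟨s₁, s₀, hs, ht, ?_, ?_, ?_⟩, lin₁, lin₀⟩, ?_, ?_⟩
  · exact fun x => h₁.1 (by rw [r₁, φ.isHom.map_unit, r₀])
  · exact fun x => h₁.1 (by rw [r₁, φ.isHom.map_inv, r₁])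
  · exact fun g k H => h₁.1 (by
      rw [r₁, φ.isHom.map_mul _ _ (by rw [← hs, ← ht, H]), r₁, r₁])
  · exact Hom.ext (funext l₁) (funext l₀)
  · exact Hom.ext (funext r₁) (funext r₀)

namespace Hom

/-! #### Conjugation of a VB-map by a transformation -/

section

variable (φ : Hom Γ Γ') {τ : Γ.obj.Total → Γ'.arr.Total}

/-- The arrow `τ(e') φ(v) τ(e)⁻¹` for an arrow `v : e → e'`. -/
noncomputable def conjArr (τ : Γ.obj.Total → Γ'.arr.Total) (v : Γ.arr.Total) : Γ'.arr.Total :=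
  Γ'.tot.mul (Γ'.tot.mul (τ (Γ.tot.tgt v)) (φ.onArr v)) (Γ'.tot.inv (τ (Γ.tot.src v)))

variable (hτ : ∀ e, Γ'.tot.src (τ e) = φ.onObj e)
include hτ

theorem conjArr_aux₁ (v : Γ.arr.Total) :
    Γ'.tot.src (τ (Γ.tot.tgt v)) = Γ'.tot.tgt (φ.onArr v) := by
  rw [hτ, φ.isHom.map_tgt]

theorem conjArr_aux₂ (v : Γ.arr.Total) :
    Γ'.tot.src (Γ'.tot.mul (τ (Γ.tot.tgt v)) (φ.onArr v)) = Γ'.tot.src (τ (Γ.tot.src v)) := by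
  rw [Γ'.tot.src_mul _ _ (φ.conjArr_aux₁ hτ v), hτ, φ.isHom.map_src]

theorem conjArr_aux₃ (v : Γ.arr.Total) :
    Γ'.tot.src (Γ'.tot.mul (τ (Γ.tot.tgt v)) (φ.onArr v)) =
      Γ'.tot.tgt (Γ'.tot.inv (τ (Γ.tot.src v))) := by
  rw [φ.conjArr_aux₂ hτ, Γ'.tot.tgt_inv]

theorem conjArr_mul (v : Γ.arr.Total) :
    Γ'.tot.mul (φ.conjArr τ v) (τ (Γ.tot.src v)) =
      Γ'.tot.mul (τ (Γ.tot.tgt v)) (φ.onArr v) :=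
  inv_mul_cancel_right (φ.conjArr_aux₂ hτ v)

theorem src_conjArr (v : Γ.arr.Total) :
    Γ'.tot.src (φ.conjArr τ v) = Γ'.tot.tgt (τ (Γ.tot.src v)) := by
  rw [conjArr, Γ'.tot.src_mul _ _ (φ.conjArr_aux₃ hτ v), Γ'.tot.src_inv]

theorem tgt_conjArr (v : Γ.arr.Total) :
    Γ'.tot.tgt (φ.conjArr τ v) = Γ'.tot.tgt (τ (Γ.tot.tgt v)) := by
  rw [conjArr, Γ'.tot.tgt_mul _ _ (φ.conjArr_aux₃ hτ v),
    Γ'.tot.tgt_mul _ _ (φ.conjArr_aux₁ hτ v)]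

/-- The VB-map obtained from `φ` by conjugation with a transformation `τ` starting at `φ`. -/
noncomputable def conj (sτ : ContMDiff Γ.obj.totalModel Γ'.arr.totalModel ∞ τ)
    (lτ : Γ.obj.IsLinearOver Γ'.arr 𝒢.unit τ) : Hom Γ Γ' where
  onArr := φ.conjArr τ
  onObj e := Γ'.tot.tgt (τ e)
  isHom := by
    refine isHom_of_mul ?_ (Γ'.tot.tgt_submersion.contMDiff.comp sτ)
      (fun v => (φ.src_conjArr hτ v).symm) (fun v => (φ.tgt_conjArr hτ v).symm) ?_ ?_
    · refine Γ'.tot.contMDiff_mul (Γ'.tot.contMDiff_mul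
        (sτ.comp Γ.tot.tgt_submersion.contMDiff) φ.isHom.smooth_arr (φ.conjArr_aux₁ hτ))
        (Γ'.tot.inv_smooth.comp (sτ.comp Γ.tot.src_submersion.contMDiff)) (φ.conjArr_aux₃ hτ)
    · intro e
      rw [conjArr, Γ.tot.src_unit, Γ.tot.tgt_unit, φ.isHom.map_unit, ← hτ, Γ'.tot.mul_unit,
        Γ'.tot.mul_inv]
    · intro v w H
      have h₁ : Γ'.tot.src (φ.conjArr τ v) = Γ'.tot.tgt (φ.conjArr τ w) := by
        rw [φ.src_conjArr hτ, φ.tgt_conjArr hτ, H]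
      have h₂ : Γ'.tot.src (φ.onArr v) = Γ'.tot.tgt (φ.onArr w) := by
        rw [← φ.isHom.map_src, ← φ.isHom.map_tgt, H]
      -- Right multiplication by `τ` at the source reduces multiplicativity to two uses of
      -- `conjArr_mul`, which moves `τ` past one factor at a time.
      refine LieGroupoid.mul_right_cancel (A := Γ'.tot)
        (h := τ (Γ.tot.src (Γ.tot.mul v w))) (φ.src_conjArr hτ _) ?_ ?_
      · rw [Γ'.tot.src_mul _ _ h₁, φ.src_conjArr hτ, Γ.tot.src_mul _ _ H]
      · rw [φ.conjArr_mul hτ, Γ.tot.src_mul _ _ H, Γ.tot.tgt_mul _ _ H, φ.isHom.map_mul _ _ H,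
          Γ'.tot.mul_assoc _ _ _ h₁ (φ.src_conjArr hτ w), φ.conjArr_mul hτ,
          ← Γ'.tot.mul_assoc _ _ _ ((φ.src_conjArr hτ v).trans (by rw [H])) (φ.conjArr_aux₁ hτ w), ← H,
          φ.conjArr_mul hτ, Γ'.tot.mul_assoc _ _ _ (φ.conjArr_aux₁ hτ v) h₂]
  arr_linear := by
    refine isLinearOver_of_isComb (fun v => ?_) fun a b p q r H => ?_
    -- `τ` lies over unit arrows, so conjugation leaves the base arrow unchanged.
    · rw [conjArr, proj_mul (φ.conjArr_aux₃ hτ v), proj_mul (φ.conjArr_aux₁ hτ v), lτ.proj,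
        Γ'.inv_linear.proj, lτ.proj, φ.proj_onArr, Γ.src_linear.proj, Γ.tgt_linear.proj, inv_unit,
        𝒢.unit_mul, 𝒢.mul_unit]
    · exact mul_isComb (mul_isComb (lτ.isComb (Γ.tgt_linear.isComb H)) (φ.arr_linear.isComb H)
        (φ.conjArr_aux₁ hτ p) (φ.conjArr_aux₁ hτ q))
        (Γ'.inv_linear.isComb (lτ.isComb (Γ.src_linear.isComb H)))
        (φ.conjArr_aux₃ hτ p) (φ.conjArr_aux₃ hτ q)
  obj_linear := Γ'.tgt_linear.comp lτ 𝒢.tgt_unit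

/-- The transformation `τ` is an isomorphism from `φ` to its conjugate. -/
noncomputable def conjIso (sτ : ContMDiff Γ.obj.totalModel Γ'.arr.totalModel ∞ τ)
    (lτ : Γ.obj.IsLinearOver Γ'.arr 𝒢.unit τ) : Iso φ (φ.conj hτ sτ lτ) where
  α := τ
  smooth := sτ
  linear := lτ
  src_α := hτ
  tgt_α _ := rfl
  natural := φ.conjArr_mul hτ

end

/-! #### VB-maps into and out of direct sums -/

/-- The projection of a direct sum onto its first summand. -/
noncomputable def fst (Γ Ω : VBGroupoid.{v} 𝒢) : Hom (Γ.sum Ω) Γ where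
  onArr := sumFst
  onObj := sumFst
  isHom := ⟨contMDiff_sumFst, contMDiff_sumFst, fun _ => rfl, fun _ => rfl, fun _ => rfl,
    fun _ => rfl, fun _ _ _ => rfl⟩
  arr_linear := sumFst_linear
  obj_linear := sumFst_linear

/-- The projection of a direct sum onto its second summand. -/
noncomputable def snd (Γ Ω : VBGroupoid.{v} 𝒢) : Hom (Γ.sum Ω) Ω where
  onArr := sumSnd
  onObj := sumSnd
  isHom := ⟨contMDiff_sumSnd, contMDiff_sumSnd, sumSnd_sumMap Γ.src_linear Ω.src_linear,
    sumSnd_sumMap Γ.tgt_linear Ω.tgt_linear, sumSnd_sumMap Γ.unit_linear Ω.unit_linear,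
    sumSnd_sumMap Γ.inv_linear Ω.inv_linear, fun _ _ h =>
      sumSnd_sumMul Γ Ω (sum_src_eq_tgt Γ Ω h).1 (sum_src_eq_tgt Γ Ω h).2⟩
  arr_linear := sumSnd_linear
  obj_linear := sumSnd_linear

/-- The VB-map into a direct sum with given components. -/
noncomputable def prod (φ : Hom Γ Γ') (ψ : Hom Γ Ω) : Hom Γ (Γ'.sum Ω) :=
  -- Both components cover the identity, so `sumMk` never replaces the second one by its default
  -- value `0`.
  have h₁ : ∀ p, sumSnd (sumMk (φ.onArr p) (ψ.onArr p)) = ψ.onArr p := fun p =>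
    sumSnd_sumMk _ _ ((ψ.proj_onArr p).trans (φ.proj_onArr p).symm)
  have h₀ : ∀ p, sumSnd (sumMk (φ.onObj p) (ψ.onObj p)) = ψ.onObj p := fun p =>
    sumSnd_sumMk _ _ ((ψ.proj_onObj p).trans (φ.proj_onObj p).symm)
  have hs : ∀ g, sumMk (φ.onObj (Γ.tot.src g)) (ψ.onObj (Γ.tot.src g)) =
      (Γ'.sum Ω).tot.src (sumMk (φ.onArr g) (ψ.onArr g)) := fun g => by
    refine sum_ext (φ.isHom.map_src g) ((h₀ _).trans ?_)
    refine Eq.trans ?_ ((snd Γ' Ω).isHom.map_src _).symm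
    exact (ψ.isHom.map_src g).trans (congrArg _ (h₁ g).symm)
  have ht : ∀ g, sumMk (φ.onObj (Γ.tot.tgt g)) (ψ.onObj (Γ.tot.tgt g)) =
      (Γ'.sum Ω).tot.tgt (sumMk (φ.onArr g) (ψ.onArr g)) := fun g => by
    refine sum_ext (φ.isHom.map_tgt g) ((h₀ _).trans ?_)
    refine Eq.trans ?_ ((snd Γ' Ω).isHom.map_tgt _).symm
    exact (ψ.isHom.map_tgt g).trans (congrArg _ (h₁ g).symm)
  { onArr := fun p => sumMk (φ.onArr p) (ψ.onArr p)
    onObj := fun p => sumMk (φ.onObj p) (ψ.onObj p)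
    isHom := by
      refine isHom_of_mul (contMDiff_sum_iff.2 ⟨φ.isHom.smooth_arr, ψ.isHom.smooth_arr.congr h₁⟩)
        (contMDiff_sum_iff.2 ⟨φ.isHom.smooth_obj, ψ.isHom.smooth_obj.congr h₀⟩) hs ht ?_ ?_
      · intro x
        refine sum_ext (φ.isHom.map_unit x) ((h₁ _).trans ?_)
        refine Eq.trans ?_ ((snd Γ' Ω).isHom.map_unit _).symm
        exact (ψ.isHom.map_unit x).trans (congrArg _ (h₀ x).symm)
      · intro g h H
        refine sum_ext (φ.isHom.map_mul g h H) ((h₁ _).trans ?_)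
        refine Eq.trans ?_ ((snd Γ' Ω).isHom.map_mul _ _ ?_).symm
        · exact (ψ.isHom.map_mul g h H).trans (congrArg₂ _ (h₁ g).symm (h₁ h).symm)
        · exact (hs g).symm.trans
            ((congrArg (fun e => sumMk (φ.onObj e) (ψ.onObj e)) H).trans (ht h))
    arr_linear := sumMk_linear φ.arr_linear ψ.arr_linear
    obj_linear := sumMk_linear φ.obj_linear ψ.obj_linear }

/-- The zero VB-map. -/
noncomputable def zero (Γ Ω : VBGroupoid.{v} 𝒢) : Hom Γ Ω :=
  have hz : ∀ {Φ : Ω.arr.Total → Ω.obj.Total} {f : G → M}, Ω.arr.IsLinearOver Ω.obj f Φ →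
      ∀ g, Φ (zeroSection _ _ g) = zeroSection _ _ (f g) := by
    rintro Φ f ⟨L, hL⟩ g
    exact (hL g 0).trans (by rw [map_zero]; rfl)
  have hs : ∀ v : Γ.arr.Total, zeroSection _ _ (Γ.tot.src v).proj =
      Ω.tot.src (zeroSection _ _ v.proj) := fun v => by
    rw [hz Ω.src_linear, Γ.src_linear.proj]
  have ht : ∀ v : Γ.arr.Total, zeroSection _ _ (Γ.tot.tgt v).proj =
      Ω.tot.tgt (zeroSection _ _ v.proj) := fun v => by
    rw [hz Ω.tgt_linear, Γ.tgt_linear.proj]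
  { onArr := fun p => zeroSection _ _ p.proj
    onObj := fun p => zeroSection _ _ p.proj
    isHom := by
      refine isHom_of_mul ((contMDiff_zeroSection ℝ _).comp (contMDiff_proj _))
        ((contMDiff_zeroSection ℝ _).comp (contMDiff_proj _)) hs ht ?_ ?_
      · intro x
        obtain ⟨L, hL⟩ := Ω.unit_linear
        rw [Γ.unit_linear.proj]
        exact ((hL x.proj 0).trans (by rw [map_zero]; rfl)).symm
      · intro g h H
        have H' : Ω.tot.src (zeroSection _ _ g.proj) = Ω.tot.tgt (zeroSection _ _ h.proj) := by
          rw [← hs, ← ht, H]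
        -- A zero vector is the combination of itself with coefficients `0, 0`. By `mul_isComb` the
        -- product of two zero vectors is again such a combination, hence zero.
        have h₀ : ∀ k : G, IsComb 0 0 (zeroSection _ _ k : Ω.arr.Total) (zeroSection _ _ k)
            (zeroSection _ _ k) := fun k => isComb_mk_iff.2 (by simp)
        obtain ⟨k, u, v, -, -, h₃⟩ := mul_isComb (h₀ g.proj) (h₀ h.proj) H' H'
        have h₄ := proj_mul H'
        rw [proj_mul H]
        rw [h₃] at h₄ ⊢
        rw [zero_smul, zero_smul, zero_add]
        exact congrArg (zeroSection _ _) h₄.symm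
    arr_linear := IsLinearOver.zero
    obj_linear := IsLinearOver.zero }

/-- The VB-map into `s^* E ⊕ t^* E` determined by its effect on objects. -/
noncomputable def toPair {E : SmoothVectorBundle.{v} IM M} {f : Γ.obj.Total → E.Total}
    (sf : ContMDiff Γ.obj.totalModel E.totalModel ∞ f)
    (lf : Γ.obj.IsLinearOver E (fun x => x) f) : Hom Γ (pair 𝒢 E) :=
  have hs : ∀ v, pairSrc (𝒢.pairMk v.proj (f (Γ.tot.src v)) (f (Γ.tot.tgt v))) =
      f (Γ.tot.src v) := fun v => pairSrc_pairMk _ (by rw [lf.proj, Γ.src_linear.proj])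
  have ht : ∀ v, pairTgt (𝒢.pairMk v.proj (f (Γ.tot.src v)) (f (Γ.tot.tgt v))) =
      f (Γ.tot.tgt v) := fun v => pairTgt_pairMk _ (by rw [lf.proj, Γ.tgt_linear.proj])
  { onArr := fun v => 𝒢.pairMk v.proj (f (Γ.tot.src v)) (f (Γ.tot.tgt v))
    onObj := f
    isHom := by
      refine isHom_of_mul (contMDiff_pair (contMDiff_proj _)
        ((sf.comp Γ.tot.src_submersion.contMDiff).congr hs)
        ((sf.comp Γ.tot.tgt_submersion.contMDiff).congr ht)) sf
        (fun v => (hs v).symm) (fun v => (ht v).symm) ?_ ?_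
      · intro x
        refine pair_ext ?_ ?_ ?_
        · exact (Γ.unit_linear.proj x).trans (congrArg 𝒢.unit (lf.proj x).symm)
        · exact (hs _).trans ((congrArg f (Γ.tot.src_unit x)).trans
            ((𝒢.pairTot E).src_unit (f x)).symm)
        · exact (ht _).trans ((congrArg f (Γ.tot.tgt_unit x)).trans
            ((𝒢.pairTot E).tgt_unit (f x)).symm)
      · intro g h H
        have H' : (𝒢.pairTot E).src (𝒢.pairMk g.proj (f (Γ.tot.src g)) (f (Γ.tot.tgt g))) =
            (𝒢.pairTot E).tgt (𝒢.pairMk h.proj (f (Γ.tot.src h)) (f (Γ.tot.tgt h))) :=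
          (hs g).trans ((congrArg f H).trans (ht h).symm)
        refine pair_ext (proj_mul H) ?_ ?_
        · exact (hs _).trans ((congrArg f (Γ.tot.src_mul _ _ H)).trans
            ((hs h).symm.trans ((𝒢.pairTot E).src_mul _ _ H').symm))
        · exact (ht _).trans ((congrArg f (Γ.tot.tgt_mul _ _ H)).trans
            ((ht g).symm.trans ((𝒢.pairTot E).tgt_mul _ _ H').symm))
    arr_linear := by
      refine isLinearOver_of_isComb (fun _ => rfl) fun a b p q r H =>
        isComb_pair H.proj_left H.proj_right ?_ ?_
      · rw [hs, hs, hs]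
        exact lf.isComb (Γ.src_linear.isComb H)
      · rw [ht, ht, ht]
        exact lf.isComb (Γ.tgt_linear.isComb H)
    obj_linear := lf }

end Hom

/-! #### Acyclic VB-groupoids -/

/-- The difference `p - p`, with the base point of the zero vector allowed to be any expression
equal to that of `p`. It also yields that linear maps preserve zero in relational form. -/
theorem zero_of_isComb_self {EB HB B : Type*} [NormedAddCommGroup EB] [NormedSpace ℝ EB]
    [TopologicalSpace HB] [TopologicalSpace B] [ChartedSpace HB B] {I : ModelWithCorners ℝ EB HB}
    {E : SmoothVectorBundle I B} {p r : E.Total} (h : IsComb 1 (-1) p p r) {x : B}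
    (hx : p.proj = x) : r = ⟨x, 0⟩ := by
  subst hx
  exact h.unique (isComb_mk_iff (u := p.2) (v := p.2).2 (by simp))

/-- The difference of `p` and `q` lies in the core and has anchor zero, so injectivity of the anchor
applies. -/
theorem IsAcyclic.unit_unique (h : Ω.IsAcyclic) {x : M} {p q : Ω.arr.Total}
    (hp : p.proj = 𝒢.unit x) (hq : q.proj = 𝒢.unit x) (hs : Ω.tot.src p = Ω.tot.src q)
    (ht : Ω.tot.tgt p = Ω.tot.tgt q) : p = q := by
  obtain ⟨g, u⟩ := p
  obtain ⟨g', w⟩ := q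
  obtain rfl : g = 𝒢.unit x := hp
  obtain rfl : g' = 𝒢.unit x := hq
  have hc := isComb_mk (E := Ω.arr) 1 (-1) u w
  have h₁ := Ω.src_linear.isComb hc
  have h₂ := Ω.tgt_linear.isComb hc
  rw [hs] at h₁
  rw [ht] at h₂
  have h₁' := zero_of_isComb_self h₁ ((Ω.src_linear.proj _).trans (𝒢.src_unit x))
  have h₂' := zero_of_isComb_self h₂ (Ω.tgt_proj_unit x w)
  have h₀ : Ω.tot.tgt ⟨𝒢.unit x, 0⟩ = ⟨x, 0⟩ :=
    zero_of_isComb_self (Ω.tgt_linear.isComb (isComb_mk_iff (x := 𝒢.unit x) (u := 0) (v := 0)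
      (w := 0) (a := 1) (b := -1).2 (by simp))) (Ω.tgt_proj_unit x 0)
  have h₃ : (⟨_, h₁'⟩ : Ω.core x) = 0 := (h x).1 (TotalSpace.mk_injective x (by
    rw [mk_anchor, mk_anchor]
    exact h₂'.trans h₀.symm))
  have h₄ := congrArg Subtype.val h₃
  have h₅ : u = w := by
    have h₆ : (1 : ℝ) • u + (-1 : ℝ) • w = 0 := h₄
    rw [one_smul, neg_one_smul, ← sub_eq_add_neg] at h₆
    exact sub_eq_zero.1 h₆
  rw [h₅]

/-- In an acyclic VB-groupoid a vector over a given arrow is determined by its source and target. -/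
theorem IsAcyclic.arr_unique (h : Ω.IsAcyclic) {p q : Ω.arr.Total} (hpq : p.proj = q.proj)
    (hs : Ω.tot.src p = Ω.tot.src q) (ht : Ω.tot.tgt p = Ω.tot.tgt q) : p = q := by
  have h₁ : Ω.tot.src p = Ω.tot.tgt (Ω.tot.inv q) := by rw [hs, Ω.tot.tgt_inv]
  have h₂ : Ω.tot.src q = Ω.tot.tgt (Ω.tot.inv q) := by rw [Ω.tot.tgt_inv]
  -- Right multiplication by the inverse of `q` moves both vectors over the unit arrow at the
  -- target.
  refine LieGroupoid.mul_right_cancel h₁ h₂ ?_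
  refine h.unit_unique (x := 𝒢.tgt q.proj) ?_ ?_ ?_ ?_
  · rw [proj_mul h₁, Ω.inv_linear.proj, hpq, 𝒢.mul_inv]
  · rw [proj_mul h₂, Ω.inv_linear.proj, 𝒢.mul_inv]
  · rw [Ω.tot.src_mul _ _ h₁, Ω.tot.src_mul _ _ h₂]
  · rw [Ω.tot.tgt_mul _ _ h₁, Ω.tot.tgt_mul _ _ h₂, ht]

/-- The source map of `Ω` is a submersion and linear over `𝒢.src`, hence surjective on each fiber.
-/
theorem exists_src_eq (Ω : VBGroupoid.{v} 𝒢) {g : G} {e : Ω.obj.Total} (he : e.proj = 𝒢.src g) :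
    ∃ p : Ω.arr.Total, p.proj = g ∧ Ω.tot.src p = e := by
  obtain ⟨L, hL⟩ := Ω.src_linear
  obtain ⟨x, u⟩ := e
  obtain rfl : x = 𝒢.src g := he
  obtain ⟨w, hw⟩ := VBAux.bundleMap_fiber_surjective 𝒢.src_submersion.contMDiff
    Ω.tot.src_submersion.contMDiff L hL Ω.tot.src_submersion.mfderiv_surjective g u
  exact ⟨⟨g, w⟩, rfl, by rw [hL, hw]⟩

/-- In an acyclic VB-groupoid there are vectors with arbitrary source and target over each
arrow. -/
theorem IsAcyclic.exists_arr (h : Ω.IsAcyclic) {g : G} {e e' : Ω.obj.Total}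
    (he : e.proj = 𝒢.src g) (he' : e'.proj = 𝒢.tgt g) :
    ∃ p : Ω.arr.Total, p.proj = g ∧ Ω.tot.src p = e ∧ Ω.tot.tgt p = e' := by
  obtain ⟨p, rfl, rfl⟩ := Ω.exists_src_eq he
  have ht := mk_toFiber (E := Ω.obj) (Ω.tgt_linear.proj p)
  have hu := mk_toFiber (E := Ω.arr) ((Ω.unit_linear.proj (Ω.tot.tgt p)).trans
    (congrArg 𝒢.unit (Ω.tgt_linear.proj p)))
  -- The vector `p` has the right source only. The defect `e' - t(p)` of its target is the anchor of
  -- a core vector `c`; then `k = 1_{t(p)} + c` goes from `t(p)` to `e'`, and `k * p` is the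
  -- required vector.
  obtain ⟨c, hc⟩ := (h (𝒢.tgt p.proj)).2
    (toFiber (𝒢.tgt p.proj) e' - toFiber (𝒢.tgt p.proj) (Ω.tot.tgt p))
  have hc' := mk_anchor Ω _ c
  rw [hc] at hc'
  have hk := isComb_mk (E := Ω.arr) 1 1
    (toFiber (𝒢.unit (𝒢.tgt p.proj)) (Ω.tot.unit (Ω.tot.tgt p))) c.1
  rw [hu] at hk
  obtain ⟨k, hk₀, hk⟩ : ∃ k : Ω.arr.Total, k.proj = 𝒢.unit (𝒢.tgt p.proj) ∧
      IsComb 1 1 (Ω.tot.unit (Ω.tot.tgt p)) ⟨_, c.1⟩ k := ⟨_, rfl, hk⟩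
  have h₁ := Ω.src_linear.isComb hk
  rw [Ω.tot.src_unit, show Ω.tot.src ⟨_, c.1⟩ = _ from c.2, ← ht] at h₁
  have h₂ := Ω.tgt_linear.isComb hk
  rw [Ω.tot.tgt_unit, ← hc', ← ht] at h₂
  have hs : Ω.tot.src k = Ω.tot.tgt p := by
    rw [← ht]
    exact h₁.unique (isComb_mk_iff.2 (by simp))
  refine ⟨Ω.tot.mul k p, ?_, Ω.tot.src_mul _ _ hs, (Ω.tot.tgt_mul _ _ hs).trans ?_⟩
  · rw [proj_mul hs, hk₀, 𝒢.unit_mul]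
  · rw [← mk_toFiber (E := Ω.obj) he']
    exact h₂.unique (isComb_mk_iff.2 (by simp [ht]))

/-- An arrow of `Γ ⊕ Ω` is an arrow of `Γ` together with a vector of `Ω` over the same base arrow,
and the latter amounts to a choice of its endpoints. -/
theorem IsAcyclic.fst_fullyFaithful (h : Ω.IsAcyclic) (Γ : VBGroupoid.{v} 𝒢) :
    (Hom.fst Γ Ω).FullyFaithful where
  faithful p q hs ht H := by
    have hp : (sumFst p).proj = (sumFst q).proj := congrArg TotalSpace.proj H
    refine sum_ext H (h.arr_unique hp ?_ ?_)
    · exact ((Hom.snd Γ Ω).isHom.map_src p).symm.trans ((congrArg sumSnd hs).trans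
        ((Hom.snd Γ Ω).isHom.map_src q))
    · exact ((Hom.snd Γ Ω).isHom.map_tgt p).symm.trans ((congrArg sumSnd ht).trans
        ((Hom.snd Γ Ω).isHom.map_tgt q))
  full e e' w hs ht := by
    obtain ⟨p, hp, hps, hpt⟩ := h.exists_arr (g := w.proj) (e := sumSnd e) (e' := sumSnd e')
      ((congrArg TotalSpace.proj hs).symm.trans (Γ.src_linear.proj w))
      ((congrArg TotalSpace.proj ht).symm.trans (Γ.tgt_linear.proj w))
    have hw : sumSnd (sumMk w p) = p := sumSnd_sumMk w p hp
    refine ⟨sumMk w p, sum_ext hs ?_, sum_ext ht ?_, rfl⟩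
    · exact ((Hom.snd Γ Ω).isHom.map_src _).trans ((congrArg Ω.tot.src hw).trans hps)
    · exact ((Hom.snd Γ Ω).isHom.map_tgt _).trans ((congrArg Ω.tot.tgt hw).trans hpt)

/-- In an acyclic VB-groupoid the vectors over units with source zero depend smoothly and linearly
on their targets. -/
theorem IsAcyclic.exists_anchor_inverse (h : Ω.IsAcyclic) :
    ∃ a : Ω.obj.Total → Ω.arr.Total, ContMDiff Ω.obj.totalModel Ω.arr.totalModel ∞ a ∧
      Ω.obj.IsLinearOver Ω.arr 𝒢.unit a ∧ (∀ e, Ω.tot.src (a e) = zeroSection _ _ e.proj) ∧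
      ∀ e, Ω.tot.tgt (a e) = e := by
  have : ∀ e : Ω.obj.Total, ∃ p : Ω.arr.Total, p.proj = 𝒢.unit e.proj ∧
      Ω.tot.src p = zeroSection _ _ e.proj ∧ Ω.tot.tgt p = e := fun e =>
    h.exists_arr (𝒢.src_unit _).symm (𝒢.tgt_unit _).symm
  choose a ha hs ht using this
  -- `χ` records base arrow, source and target, so it is injective on fibers, and `χ ∘ a` is the
  -- visibly smooth map `e ↦ (0, e)` over units. This gives the smoothness of the chosen `a`.
  let χ : Hom Ω (pair 𝒢 Ω.obj) := Hom.toPair contMDiff_id ⟨fun _ => LinearMap.id, fun _ _ => rfl⟩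
  have hχs : ∀ v, pairSrc (χ.onArr v) = Ω.tot.src v := fun v => (χ.isHom.map_src v).symm
  have hχt : ∀ v, pairTgt (χ.onArr v) = Ω.tot.tgt v := fun v => (χ.isHom.map_tgt v).symm
  refine ⟨a, ?_, isLinearOver_of_isComb ha fun b c p q r H => ?_, hs, ht⟩
  · refine contMDiff_of_comp_injective contMDiff_id χ.isHom.smooth_arr χ.arr_linear ?_ ?_ ?_
    · intro p q hpq H
      refine h.arr_unique hpq ?_ ?_
      · rw [← hχs, H, hχs]
      · rw [← hχt, H, hχt]
    · exact (𝒢.unit_smooth.comp (contMDiff_proj _)).congr ha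
    · refine contMDiff_pair ?_ ?_ ?_
      · exact (𝒢.unit_smooth.comp (contMDiff_proj _)).congr ha
      · exact ((contMDiff_zeroSection ℝ _).comp (contMDiff_proj _)).congr
          fun e => (hχs _).trans (hs e)
      · exact contMDiff_id.congr fun e => (hχt _).trans (ht e)
  · have h₁ := mk_toFiber (E := Ω.arr) ((ha p).trans (congrArg 𝒢.unit H.proj_left))
    have h₂ := mk_toFiber (E := Ω.arr) ((ha q).trans (congrArg 𝒢.unit H.proj_right))
    have hz := isComb_mk (E := Ω.arr) b c (toFiber (𝒢.unit r.proj) (a p))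
      (toFiber (𝒢.unit r.proj) (a q))
    rw [h₁, h₂] at hz
    -- The combination `z` of `a p` and `a q` has the same base arrow and endpoints as `a r`, hence
    -- equals it.
    obtain ⟨z, hz₀, hz⟩ : ∃ z : Ω.arr.Total, z.proj = 𝒢.unit r.proj ∧ IsComb b c (a p) (a q) z :=
      ⟨_, rfl, hz⟩
    have hzs := Ω.src_linear.isComb hz
    have hzt := Ω.tgt_linear.isComb hz
    rw [hs, hs] at hzs
    rw [ht, ht] at hzt
    have : a r = z := by
      refine h.arr_unique ((ha r).trans hz₀.symm) ?_ ?_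
      · rw [hs]
        exact IsComb.unique ((IsLinearOver.zero (E := Ω.obj) (E' := Ω.obj)
          (f := fun x => x)).isComb H) hzs
      · rw [ht]
        exact H.unique hzt
    rwa [this]

/-! ### Acyclic summands and equivalence -/

/-- Adding an acyclic summand does not change the VB-groupoid up to equivalence. -/
theorem IsAcyclic.inl_fst_iso (h : Ω.IsAcyclic) (Γ : VBGroupoid.{v} 𝒢) :
    Nonempty (Hom.Iso (((Hom.id Γ).prod (Hom.zero Γ Ω)).comp (Hom.fst Γ Ω))
      (Hom.id (Γ.sum Ω))) := by
  obtain ⟨a, sa, la, as, at'⟩ := h.exists_anchor_inverse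
  have hp : ∀ e : (Γ.obj.sum Ω.obj).Total,
      (a (sumSnd e)).proj = (Γ.tot.unit (sumFst e)).proj := fun e =>
    (la.proj (sumSnd e)).trans (Γ.unit_linear.proj (sumFst e)).symm
  have hα : ∀ e : (Γ.obj.sum Ω.obj).Total,
      sumSnd (sumMk (Γ.tot.unit (sumFst e)) (a (sumSnd e))) = a (sumSnd e) := fun e =>
    sumSnd_sumMk _ _ (hp e)
  have hsrc : ∀ e, (Γ.sum Ω).tot.src (sumMk (Γ.tot.unit (sumFst e)) (a (sumSnd e))) =
      (((Hom.id Γ).prod (Hom.zero Γ Ω)).comp (Hom.fst Γ Ω)).onObj e := fun e => by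
    refine sum_ext (Γ.tot.src_unit _) ?_
    refine ((Hom.snd Γ Ω).isHom.map_src _).trans ((congrArg Ω.tot.src (hα e)).trans ?_)
    exact (as _).trans (sumSnd_sumMk (sumFst e) (zeroSection _ _ (sumFst e).proj) rfl).symm
  have htgt : ∀ e, (Γ.sum Ω).tot.tgt (sumMk (Γ.tot.unit (sumFst e)) (a (sumSnd e))) = e :=
    fun e => sum_ext (Γ.tot.tgt_unit _) (((Hom.snd Γ Ω).isHom.map_tgt _).trans
      ((congrArg Ω.tot.tgt (hα e)).trans (at' _)))
  -- The arrow `(1_e, a(e'))` goes from `(e, 0)` to `(e, e')`.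
  refine ⟨⟨fun e => sumMk (Γ.tot.unit (sumFst e)) (a (sumSnd e)), ?_, ?_, hsrc, htgt, ?_⟩⟩
  · exact contMDiff_sumMk hp (Γ.tot.unit_smooth.comp contMDiff_sumFst) (sa.comp contMDiff_sumSnd)
  · exact sumMk_linear (Γ.unit_linear.comp sumFst_linear fun _ => rfl)
      (la.comp sumSnd_linear fun _ => rfl)
  · intro v
    set κ := ((Hom.id Γ).prod (Hom.zero Γ Ω)).comp (Hom.fst Γ Ω)
    have h₁ : (Γ.sum Ω).tot.src ((Hom.id (Γ.sum Ω)).onArr v) = (Γ.sum Ω).tot.tgt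
        (sumMk (Γ.tot.unit (sumFst ((Γ.sum Ω).tot.src v)))
          (a (sumSnd ((Γ.sum Ω).tot.src v)))) := (htgt _).symm
    have h₂ : (Γ.sum Ω).tot.src (sumMk (Γ.tot.unit (sumFst ((Γ.sum Ω).tot.tgt v)))
          (a (sumSnd ((Γ.sum Ω).tot.tgt v)))) = (Γ.sum Ω).tot.tgt (κ.onArr v) :=
      (hsrc _).trans (κ.isHom.map_tgt v)
    -- The two composites share their endpoints, so it is enough to compare them in `Γ`, where
    -- naturality reduces to the unit laws.
    refine (h.fst_fullyFaithful Γ).faithful _ _ ?_ ?_ ?_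
    · rw [(Γ.sum Ω).tot.src_mul _ _ h₁, (Γ.sum Ω).tot.src_mul _ _ h₂]
      exact (hsrc _).trans (κ.isHom.map_src v)
    · rw [(Γ.sum Ω).tot.tgt_mul _ _ h₁, (Γ.sum Ω).tot.tgt_mul _ _ h₂]
      exact (htgt ((Γ.sum Ω).tot.tgt v)).symm
    · exact (Γ.tot.mul_unit (sumFst v)).trans (Γ.tot.unit_mul (sumFst v)).symm

/-- VB-groupoids that become isomorphic after adding acyclic summands are equivalent. -/
theorem Isomorphic.equivalent_of_sum (hΩ : Ω.IsAcyclic) (hΩ' : Ω'.IsAcyclic)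
    (h : (Γ.sum Ω).Isomorphic (Γ'.sum Ω')) : Γ.Equivalent Γ' := by
  obtain ⟨Φ, Ψ, h₁, h₂⟩ := h
  obtain ⟨θ⟩ := hΩ.inl_fst_iso Γ
  obtain ⟨θ'⟩ := hΩ'.inl_fst_iso Γ'
  let ι := (Hom.id Γ).prod (Hom.zero Γ Ω)
  let ι' := (Hom.id Γ').prod (Hom.zero Γ' Ω')
  -- In the composite of the two candidate quasi-inverses, `ι'` followed from the right by a
  -- projection occurs in the middle as `ι' ∘ fst`. Whiskering `θ'` replaces this factor by the
  -- identity, after which `Ψ` and `Φ` cancel and `fst ∘ ι` is the identity definitionally.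
  have e₁ : ((Hom.fst Γ Ω).comp Ψ).comp ((Hom.id (Γ'.sum Ω')).comp (Φ.comp ι)) = Hom.id Γ := by
    change (Hom.fst Γ Ω).comp ((Ψ.comp Φ).comp ι) = _
    rw [h₁]
    rfl
  have e₂ : ((Hom.fst Γ' Ω').comp Φ).comp ((Hom.id (Γ.sum Ω)).comp (Ψ.comp ι')) = Hom.id Γ' := by
    change (Hom.fst Γ' Ω').comp ((Φ.comp Ψ).comp ι') = _
    rw [h₂]
    rfl
  have w₁ := θ'.whisker ((Hom.fst Γ Ω).comp Ψ) (Φ.comp ι)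
  have w₂ := θ.whisker ((Hom.fst Γ' Ω').comp Φ) (Ψ.comp ι')
  rw [e₁] at w₁
  rw [e₂] at w₂
  exact ⟨(Hom.fst Γ' Ω').comp (Φ.comp ι), (Hom.fst Γ Ω).comp (Ψ.comp ι'), ⟨w₁⟩, ⟨w₂⟩⟩

/-- The identity `(p + q) - p = q`, which computes the source of the transformation `τ` in
`Equivalent.isomorphic_sum_pair`. -/
theorem isComb_sub_cancel {EB HB B : Type*} [NormedAddCommGroup EB] [NormedSpace ℝ EB]
    [TopologicalSpace HB] [TopologicalSpace B] [ChartedSpace HB B] {I : ModelWithCorners ℝ EB HB}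
    {E : SmoothVectorBundle I B} {p q r s : E.Total} (h : IsComb 1 1 p q r)
    (h' : IsComb 1 (-1) r p s) : s = q := by
  obtain ⟨x, u, w, rfl, rfl, rfl⟩ := h
  exact h'.unique (isComb_mk_iff.2 (by simp))

/-- Equivalent VB-groupoids become isomorphic after adding acyclic summands. -/
theorem Equivalent.isomorphic_sum_pair (h : Γ.Equivalent Γ') :
    (Γ.sum (pair 𝒢 Γ'.obj)).Isomorphic (Γ'.sum (pair 𝒢 Γ.obj)) := by
  obtain ⟨φ, hφ⟩ := h
  have ff := hφ.fullyFaithful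
  obtain ⟨ψ, -, ⟨β⟩⟩ := hφ
  let A := Γ.sum (pair 𝒢 Γ'.obj)
  let p₁ : A.obj.Total → Γ.obj.Total := sumFst
  let p₂ : A.obj.Total → Γ'.obj.Total := sumSnd
  have s₁ : ContMDiff A.obj.totalModel Γ.obj.totalModel ∞ p₁ := contMDiff_sumFst
  have s₂ : ContMDiff A.obj.totalModel Γ'.obj.totalModel ∞ p₂ := contMDiff_sumSnd
  have l₁ : A.obj.IsLinearOver Γ.obj (fun x => x) p₁ := sumFst_linear
  have l₂ : A.obj.IsLinearOver Γ'.obj (fun x => x) p₂ := sumSnd_linear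
  have lφ := φ.obj_linear.comp l₁ (f'' := fun x => x) fun _ => rfl
  have lψ := ψ.obj_linear.comp l₂ (f'' := fun x => x) fun _ => rfl
  have lφψ := φ.obj_linear.comp lψ (f'' := fun x => x) fun _ => rfl
  -- At `(u, w)`, `σ = β(w) + 1_{φ(u)}` and `τ = σ - 1_{φψ(w)}`, all over the unit arrow. The
  -- correction cancels the source `φψ(w)` of `β(w)`, so `τ` starts at `φ(u)` and ends at `w + φ(u)
  -- - φψ(w)`.
  obtain ⟨σ, sσ, lσ, hσ⟩ := exists_isComb_map 𝒢.unit_smooth 1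
    (β.linear.comp l₂ (f'' := 𝒢.unit) fun _ => rfl)
    (Γ'.unit_linear.comp lφ (f'' := 𝒢.unit) fun _ => rfl) (β.smooth.comp s₂)
    (Γ'.tot.unit_smooth.comp (φ.isHom.smooth_obj.comp s₁))
  obtain ⟨τ, sτ, lτ, hτ⟩ := exists_isComb_map 𝒢.unit_smooth (-1) lσ
    (Γ'.unit_linear.comp lφψ (f'' := 𝒢.unit) fun _ => rfl) sσ
    (Γ'.tot.unit_smooth.comp (φ.isHom.smooth_obj.comp (ψ.isHom.smooth_obj.comp s₂)))
  -- `f(u, w) = u - ψ(w)` is the second component on objects, chosen to make the total map on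
  -- objects invertible.
  obtain ⟨f, sf, lf, hf⟩ := exists_isComb_map contMDiff_id (-1) l₁ lψ s₁
    (ψ.isHom.smooth_obj.comp s₂)
  have hsrc : ∀ e, Γ'.tot.src (τ e) = (φ.comp (Hom.fst Γ (pair 𝒢 Γ'.obj))).onObj e := fun e => by
    have h₁ := Γ'.src_linear.isComb (hσ e)
    have h₂ := Γ'.src_linear.isComb (hτ e)
    rw [β.src_α, Γ'.tot.src_unit] at h₁
    rw [Γ'.tot.src_unit] at h₂
    exact isComb_sub_cancel h₁ h₂
  let F₁ := (φ.comp (Hom.fst Γ (pair 𝒢 Γ'.obj))).conj hsrc sτ lτ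
  let F : Hom A (Γ'.sum (pair 𝒢 Γ.obj)) := F₁.prod (Hom.toPair sf lf)
  -- The first component of `F` is `F₁`, which is isomorphic through `τ` to a composite of fully
  -- faithful maps.
  have hF : ((Hom.fst Γ' (pair 𝒢 Γ.obj)).comp F).FullyFaithful :=
    (ff.comp ((pair_isAcyclic 𝒢 Γ'.obj).fst_fullyFaithful Γ)).of_iso
      (Hom.conjIso _ hsrc sτ lτ)
  have hF' : F.FullyFaithful :=
    hF.of_comp ((pair_isAcyclic 𝒢 Γ.obj).fst_fullyFaithful Γ').faithful
  suffices h₀ : Function.Bijective F.onObj from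
    isomorphic_of_bijective F (hF'.onArr_bijective h₀) h₀
  obtain ⟨L, hL⟩ : ∃ L : ∀ x, Γ.obj.Fiber x →ₗ[ℝ] Γ'.obj.Fiber x,
    ∀ x u, φ.onObj ⟨x, u⟩ = ⟨x, L x u⟩ := φ.obj_linear
  obtain ⟨L', hL'⟩ : ∃ L : ∀ x, Γ'.obj.Fiber x →ₗ[ℝ] Γ.obj.Fiber x,
    ∀ x u, ψ.onObj ⟨x, u⟩ = ⟨x, L x u⟩ := ψ.obj_linear
  have hF₀ : ∀ (x : M) (u : Γ.obj.Fiber x) (w : Γ'.obj.Fiber x),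
      F.onObj ⟨x, (u, w)⟩ = ⟨x, (w + L x u - L x (L' x w), u - L' x w)⟩ := by
    intro x u w
    have h₁ := Γ'.tgt_linear.isComb (hσ ⟨x, (u, w)⟩)
    have h₂ := Γ'.tgt_linear.isComb (hτ ⟨x, (u, w)⟩)
    have h₃ := hf ⟨x, (u, w)⟩
    change IsComb 1 (-1) (⟨x, u⟩ : Γ.obj.Total) (ψ.onObj ⟨x, w⟩) _ at h₃
    rw [β.tgt_α, Γ'.tot.tgt_unit] at h₁
    change IsComb 1 1 (⟨x, w⟩ : Γ'.obj.Total) (φ.onObj ⟨x, u⟩) _ at h₁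
    rw [hL] at h₁
    rw [h₁.unique (isComb_mk _ _ _ _), Γ'.tot.tgt_unit] at h₂
    change IsComb 1 (-1) _ (φ.onObj (ψ.onObj ⟨x, w⟩)) _ at h₂
    rw [hL', hL] at h₂
    rw [hL'] at h₃
    refine sum_ext ?_ ?_
    · exact h₂.unique (isComb_mk_iff.2 (by simp [sub_eq_add_neg]))
    · exact (sumSnd_sumMk _ _ (((Hom.toPair sf lf).proj_onObj _).trans
        (F₁.proj_onObj _).symm)).trans (h₃.unique (isComb_mk_iff.2 (by simp [sub_eq_add_neg])))
  -- The inverse has the same form with `L` and `L'` exchanged. Both composites cancel by linearity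
  -- alone, without any relation between `L` and `L'`.
  let K : ∀ x, Γ'.obj.Fiber x → Γ.obj.Fiber x → A.obj.Total := fun x u w =>
    ⟨x, (L' x u + w - L' x (L x w), u - L x w)⟩
  refine Function.bijective_iff_has_inverse.2 ⟨fun e => K e.proj e.2.1 e.2.2, ?_, ?_⟩
  · rintro ⟨x, u, w⟩
    refine (congrArg (fun e : (Γ'.sum (pair 𝒢 Γ.obj)).obj.Total => K e.proj e.2.1 e.2.2)
      (hF₀ x u w)).trans ?_
    refine congrArg (TotalSpace.mk x) (Prod.ext ?_ ?_)
    · change Γ'.obj.Fiber x at w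
      change L' x (w + L x u - L x (L' x w)) + (u - L' x w) - L' x (L x (u - L' x w)) = u
      simp only [map_sub, map_add]
      abel
    · change Γ'.obj.Fiber x at w
      change w + L x u - L x (L' x w) - L x (u - L' x w) = w
      rw [map_sub]
      abel
  · rintro ⟨x, u, w⟩
    refine (hF₀ x _ _).trans (congrArg (TotalSpace.mk x) (Prod.ext ?_ ?_))
    · change Γ.obj.Fiber x at w
      change u - L x w + L x (L' x u + w - L' x (L x w)) - L x (L' x (u - L x w)) = u
      simp only [map_sub, map_add]
      abel
    · change Γ.obj.Fiber x at w
      change L' x u + w - L' x (L x w) - L' x (u - L x w) = w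
      rw [map_sub]
      abel

end VBGroupoid

end VB

theorem mainTheorem6 {EG HG G EM HM M : Type*}
    [NormedAddCommGroup EG] [NormedSpace ℝ EG] [FiniteDimensional ℝ EG] [TopologicalSpace HG]
    {IG : ModelWithCorners ℝ EG HG} [IG.Boundaryless]
    [TopologicalSpace G] [ChartedSpace HG G] [IsManifold IG ∞ G]
    [NormedAddCommGroup EM] [NormedSpace ℝ EM] [FiniteDimensional ℝ EM] [TopologicalSpace HM]
    {IM : ModelWithCorners ℝ EM HM} [IM.Boundaryless]
    [TopologicalSpace M] [ChartedSpace HM M] [IsManifold IM ∞ M]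
    (𝒢 : LieGroupoid IG G IM M) (Γ Γ' : VBGroupoid.{v} 𝒢) :
    Γ.Equivalent Γ' ↔
      ∃ Ω Ω' : VBGroupoid.{v} 𝒢, Ω.IsAcyclic ∧ Ω'.IsAcyclic ∧
        (Γ.sum Ω).Isomorphic (Γ'.sum Ω') :=
  ⟨fun h => ⟨_, _, VBGroupoid.pair_isAcyclic 𝒢 Γ'.obj, VBGroupoid.pair_isAcyclic 𝒢 Γ.obj,
    h.isomorphic_sum_pair⟩, fun ⟨_, _, hΩ, hΩ', h⟩ => h.equivalent_of_sum hΩ hΩ'⟩
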